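/- Let $n\ge 1$, let $\Omega\subset\mathbb R^n$ be a bounded open set with $C^2$-smooth boundary (near each boundary point, $\Omega$ is the set $\{r<0\}$ for some real $C^2$ function $r$ with $\nabla r\neq 0$), and let $d(x)=\operatorname{dist}(x,\partial\Omega)$ for $x\in\Omega$. Say that $G:(0,\infty)\to\mathbb R$ satisfies condition $(\Sigma)$ if $G\in C^1(0,\infty)$ and there exists $d_0>0$ such that 1. $0\le G'(t)\le \frac1t$ for $t\in(0,d_0)$ and $G'(t)=0$ for $t\ge d_0$; 2. for every $0<\rho_0\le \frac{d_0}{2}$, $\displaystyle\sum_{k=1}^\infty 4^{-k}e^{-2G(2^{-k}\rho_0)}=\infty$. Let $V\in L^\infty_{\mathrm{loc}}(\Omega)$ be real-valued and suppose that there exist a function $G$ satisfying condition $(\Sigma)$ and real-valued functions $V_1,V_2$ with $V=V_1+V_2$ such that $V_2\in L^\infty(\Omega)$ and $$V_1(x)+\frac14\cdot\frac1{d(x)^2}\ \ge\ G'(d(x))^2\qquad\text{for almost every }x\in\Omega.$$ Then the Schrödinger operator $H=-\Delta+V$ with domain $\mathcal D(H)=C_0^\infty(\Omega)$ is essentially self-adjoint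 in the complex Hilbert space $L^2(\Omega)$; that is, $H$ is densely defined and symmetric, and its closure is self-adjoint. -/

import Mathlib

open MeasureTheory Set Filter TopologicalSpace
open scoped Distributions ENNReal Topology

/-- An open set `Ω ⊆ ℝⁿ` has `C²`-smooth boundary: near each boundary point it is the sublevel set
`{r < 0}` of a real-valued `C²` function `r` without critical points. -/
def HasC2Boundary {n : ℕ} (Ω : Opens (EuclideanSpace ℝ (Fin n))) : Prop :=
  ∀ x₀ ∈ frontier (Ω : Set (EuclideanSpace ℝ (Fin n))),
    ∃ (U : Set (EuclideanSpace ℝ (Fin n))) (r : EuclideanSpace ℝ (Fin n) → ℝ),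
      IsOpen U ∧ x₀ ∈ U ∧ ContDiffOn ℝ 2 r U ∧ (∀ x ∈ U, fderiv ℝ r x ≠ 0) ∧
        (Ω : Set (EuclideanSpace ℝ (Fin n))) ∩ U = {x | x ∈ U ∧ r x < 0}

/-- The Euclidean distance to the boundary of `Ω`. -/
noncomputable def bdryDist {n : ℕ} (Ω : Opens (EuclideanSpace ℝ (Fin n)))
    (x : EuclideanSpace ℝ (Fin n)) : ℝ :=
  Metric.infDist x (frontier (Ω : Set (EuclideanSpace ℝ (Fin n))))

/-- Condition (Σ) on a function `G` on `(0, ∞)`; only the values of `G` on `(0, ∞)` matter. -/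
def ConditionSigma (G : ℝ → ℝ) : Prop :=
  ContDiffOn ℝ 1 G (Ioi 0) ∧
    ∃ d₀ : ℝ, 0 < d₀ ∧
      (∀ t, 0 < t → t < d₀ → 0 ≤ deriv G t ∧ deriv G t ≤ 1 / t) ∧
      (∀ t, d₀ ≤ t → deriv G t = 0) ∧
      ∀ ρ₀, 0 < ρ₀ → ρ₀ ≤ d₀ / 2 →
        Tendsto
          (fun N : ℕ => ∑ k ∈ Finset.Icc 1 N,
            ((4 : ℝ) ^ k)⁻¹ * Real.exp (-2 * G (((2 : ℝ) ^ k)⁻¹ * ρ₀)))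
          atTop atTop

/-- `V ∈ L^∞_loc(Ω)`: measurable and essentially bounded on every compact subset of `Ω`. -/
def LocallyLInfty {n : ℕ} (Ω : Opens (EuclideanSpace ℝ (Fin n)))
    (V : EuclideanSpace ℝ (Fin n) → ℝ) : Prop :=
  ∀ K : Set (EuclideanSpace ℝ (Fin n)), IsCompact K → K ⊆ (Ω : Set (EuclideanSpace ℝ (Fin n))) →
    MemLp V ∞ (volume.restrict K)

/-- The complex Hilbert space `L²(Ω)`. -/
noncomputable abbrev L2 {n : ℕ} (Ω : Opens (EuclideanSpace ℝ (Fin n))) : Type :=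
  Lp ℂ 2 (volume.restrict (Ω : Set (EuclideanSpace ℝ (Fin n))))

/-- The function `-Δφ + Vφ`. -/
noncomputable def schrodingerFun {n : ℕ} (V : EuclideanSpace ℝ (Fin n) → ℝ)
    (φ : EuclideanSpace ℝ (Fin n) → ℂ) (x : EuclideanSpace ℝ (Fin n)) : ℂ :=
  -(Laplacian.laplacian φ x) + (V x : ℂ) * φ x

section

variable {n : ℕ} {Ω : Opens (EuclideanSpace ℝ (Fin n))}

theorem testFunction_memLp (φ : 𝓓(Ω, ℂ)) :
    MemLp φ 2 (volume.restrict (Ω : Set (EuclideanSpace ℝ (Fin n)))) :=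
  φ.continuous.memLp_of_hasCompactSupport φ.hasCompactSupport

theorem testFunction_contDiffAt (φ : 𝓓(Ω, ℂ)) (x : EuclideanSpace ℝ (Fin n)) :
    ContDiffAt ℝ 2 φ x :=
  (φ.contDiff.of_le (WithTop.coe_le_coe.2 (le_top : (2 : ℕ∞) ≤ ⊤))).contDiffAt

theorem testFunction_laplacian_eq (φ : 𝓓(Ω, ℂ)) :
    Laplacian.laplacian (φ : EuclideanSpace ℝ (Fin n) → ℂ) =
      fun x => ∑ i, iteratedFDeriv ℝ 2 φ x
        ![EuclideanSpace.basisFun (Fin n) ℝ i, EuclideanSpace.basisFun (Fin n) ℝ i] :=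
  InnerProductSpace.laplacian_eq_iteratedFDeriv_orthonormalBasis _ _

theorem testFunction_laplacian_memLp (φ : 𝓓(Ω, ℂ)) :
    MemLp (Laplacian.laplacian (φ : EuclideanSpace ℝ (Fin n) → ℂ)) 2
      (volume.restrict (Ω : Set (EuclideanSpace ℝ (Fin n)))) := by
  have hc : Continuous (Laplacian.laplacian (φ : EuclideanSpace ℝ (Fin n) → ℂ)) := by
    rw [testFunction_laplacian_eq]
    refine continuous_finsetSum _ fun i _ => ?_
    have h : Continuous (iteratedFDeriv ℝ 2 φ) :=
      φ.contDiff.continuous_iteratedFDeriv (m := 2) (WithTop.coe_le_coe.2 (le_top : (2 : ℕ∞) ≤ ⊤))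
    exact h.eval_const _
  refine hc.memLp_of_hasCompactSupport ?_
  have hs : HasCompactSupport (iteratedFDeriv ℝ 2 φ) := φ.hasCompactSupport.iteratedFDeriv 2
  refine hs.mono fun x hx => ?_
  contrapose! hx
  simp only [Function.mem_support, not_not] at hx ⊢
  rw [testFunction_laplacian_eq]
  simp [hx]

theorem schrodingerFun_memLp {V : EuclideanSpace ℝ (Fin n) → ℝ} (hV : LocallyLInfty Ω V)
    (φ : 𝓓(Ω, ℂ)) :
    MemLp (schrodingerFun V φ) 2 (volume.restrict (Ω : Set (EuclideanSpace ℝ (Fin n)))) := by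
  refine (testFunction_laplacian_memLp φ).neg.add ?_
  have hK := hV (tsupport φ) φ.hasCompactSupport φ.tsupport_subset
  have hφ : MemLp φ 2 (volume.restrict (tsupport φ)) :=
    φ.continuous.memLp_of_hasCompactSupport φ.hasCompactSupport
  have h : MemLp (fun x => (V x : ℂ) * φ x) 2 (volume.restrict (tsupport φ)) :=
    hφ.mul hK.ofReal
  have hm : MeasurableSet (tsupport φ) := (isClosed_tsupport _).measurableSet
  rw [← memLp_indicator_iff_restrict hm] at h
  have he : (tsupport φ).indicator (fun x => (V x : ℂ) * φ x) = fun x => (V x : ℂ) * φ x := by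
    rw [indicator_eq_self]
    intro x hx
    refine subset_tsupport _ ?_
    simp only [Function.mem_support] at hx ⊢
    exact right_ne_zero_of_mul hx
  rw [he] at h
  exact h.restrict _

/-- The inclusion `C₀^∞(Ω) → L²(Ω)`. -/
noncomputable def testToL2 (Ω : Opens (EuclideanSpace ℝ (Fin n))) : 𝓓(Ω, ℂ) →ₗ[ℂ] L2 Ω where
  toFun φ := (testFunction_memLp φ).toLp φ
  map_add' _ _ := rfl
  map_smul' _ _ := rfl

theorem testToL2_injective (Ω : Opens (EuclideanSpace ℝ (Fin n))) :
    Function.Injective (testToL2 Ω) := by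
  intro φ ψ h
  have h' := (MemLp.toLp_eq_toLp_iff (testFunction_memLp φ) (testFunction_memLp ψ)).1 h
  have hon := Measure.eqOn_open_of_ae_eq h' Ω.isOpen φ.continuous.continuousOn
    ψ.continuous.continuousOn
  ext x
  by_cases hx : x ∈ (Ω : Set (EuclideanSpace ℝ (Fin n)))
  · exact hon hx
  · rw [image_eq_zero_of_notMem_tsupport fun hc => hx (φ.tsupport_subset hc),
      image_eq_zero_of_notMem_tsupport fun hc => hx (ψ.tsupport_subset hc)]

/-- The map `φ ↦ -Δφ + Vφ` from `C₀^∞(Ω)` to `L²(Ω)`. -/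
noncomputable def schrodingerMap {V : EuclideanSpace ℝ (Fin n) → ℝ} (hV : LocallyLInfty Ω V) :
    𝓓(Ω, ℂ) →ₗ[ℂ] L2 Ω where
  toFun φ := (schrodingerFun_memLp hV φ).toLp (schrodingerFun V φ)
  map_add' φ ψ := by
    rw [← MemLp.toLp_add]
    congr 1
    funext x
    have h := (testFunction_contDiffAt φ x).laplacian_add (testFunction_contDiffAt ψ x)
    change -(Laplacian.laplacian ((φ : EuclideanSpace ℝ (Fin n) → ℂ) + ψ) x)
      + (V x : ℂ) * (φ x + ψ x) = schrodingerFun V φ x + schrodingerFun V ψ x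
    rw [h, schrodingerFun, schrodingerFun]
    ring
  map_smul' c φ := by
    rw [RingHom.id_apply, ← MemLp.toLp_const_smul]
    congr 1
    funext x
    have h := InnerProductSpace.laplacian_smul c (testFunction_contDiffAt φ x)
    change -(Laplacian.laplacian (c • (φ : EuclideanSpace ℝ (Fin n) → ℂ)) x)
      + (V x : ℂ) * (c • φ x) = c • schrodingerFun V φ x
    rw [h, schrodingerFun, smul_eq_mul, smul_eq_mul, smul_eq_mul]
    ring

end

/-- The Schrödinger operator `H = -Δ + V` in `L²(Ω)` with domain `C₀^∞(Ω)`. -/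
noncomputable def schrodingerOp {n : ℕ} (Ω : Opens (EuclideanSpace ℝ (Fin n)))
    (V : EuclideanSpace ℝ (Fin n) → ℝ) (hV : LocallyLInfty Ω V) : L2 Ω →ₗ.[ℂ] L2 Ω where
  domain := LinearMap.range (testToL2 Ω)
  toFun := schrodingerMap hV ∘ₗ
    (LinearEquiv.ofInjective (testToL2 Ω) (testToL2_injective Ω)).symm.toLinearMap

theorem schrodingerOp_apply {n : ℕ} (Ω : Opens (EuclideanSpace ℝ (Fin n)))
    (V : EuclideanSpace ℝ (Fin n) → ℝ) (hV : LocallyLInfty Ω V) (φ : 𝓓(Ω, ℂ)) :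
    schrodingerOp Ω V hV ⟨testToL2 Ω φ, LinearMap.mem_range_self _ φ⟩ = schrodingerMap hV φ :=
  congrArg (schrodingerMap hV) ((LinearEquiv.symm_apply_eq _).2 (Subtype.ext rfl))

/-- A densely defined symmetric operator is essentially self-adjoint if its closure is
self-adjoint. -/
def IsEssentiallySelfAdjoint {F : Type*} [NormedAddCommGroup F] [InnerProductSpace ℂ F]
    [CompleteSpace F] (A : F →ₗ.[ℂ] F) : Prop :=
  Dense (A.domain : Set F) ∧ A.IsFormalAdjoint A ∧ A.IsClosable ∧ IsSelfAdjoint A.closure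

/-! ### Essential self-adjointness from coercivity and density of the range. -/

section FunctionalAnalysis

variable {F : Type*} [NormedAddCommGroup F] [InnerProductSpace ℂ F]

/-! Let δ be the distance to the complement of Ω. Hardy's inequality with constant 1/4 says that -Δ
≥ 1/(4δ²) - const as quadratic forms on test functions. With the lower bound on V₁ and the
boundedness of V₂ it gives H - E ≥ 1 for a suitable real E. Essential self-adjointness then reduces
to density of the range of H - E (`isEssentiallySelfAdjoint_of_coercive`): square integrable
distributional solutions of (-Δ + V - E)ψ = 0 must vanish. Since V is real, real solutions u
suffice.

Hardy's inequality (`hardy_inequality`) rests on a weak upper bound Δδ ≤ K. A bounded set with C²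
boundary has exterior balls of one radius ρ; at each point of Ω, δ is touched from above by the
distance to such a ball, so its second differences are at most |w|²/ρ, and K = n/ρ works. Then
√(δ/(1 + Kδ)) is a positive supersolution of -Δ - 1/(4δ²) + 3K²/4.

Solutions vanish by an Agmon argument. For Lipschitz f with compact support in Ω, the equation
tested against f²u and Hardy's inequality for fu give ∫ (1/(4δ²) - 3K²/4 + V - E) f²u² ≤ ∫ |∇f|² u²
(`IsWeakSolution.localized_energy_inequality`). No derivative of u occurs, so the inequality passes
from mollifications to u without regularity theory. Take f = exp(G(δ)), cut off on the shell s/2 ≤ δ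
< s. Since |∇δ| = 1, the term G'(δ)²f² is absorbed by the potential, and the mass of u in the
interior is at most C s⁻² exp(2G(s)) times its mass in the shell
(`IsWeakSolution.interior_mass_le_shell_mass`). For s = 2⁻ᵏρ₀ the shells are disjoint; multiplying
by 4⁻ᵏ exp(-2G(s)) and summing over k, condition (Σ) makes the left side diverge unless the interior
mass is zero, while the right side stays bounded by a multiple of ‖u‖²
(`IsWeakSolution.ae_eq_zero`). -/

theorem LinearPMap.IsFormalAdjoint.inner_eq_of_mem_closure_graph {A : F →ₗ.[ℂ] F}
    (hs : A.IsFormalAdjoint A) {p q : F × F} (hp : p ∈ A.graph.topologicalClosure)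
    (hq : q ∈ A.graph.topologicalClosure) : inner ℂ p.2 q.1 = inner ℂ p.1 q.2 := by
  have h1 : ∀ p ∈ A.graph, ∀ q ∈ A.graph, inner ℂ p.2 q.1 = inner ℂ p.1 q.2 := by
    rintro p hp q hq
    obtain ⟨x, hx, hx'⟩ := (LinearPMap.mem_graph_iff A).1 hp
    obtain ⟨y, hy, hy'⟩ := (LinearPMap.mem_graph_iff A).1 hq
    rw [← hx, ← hx', ← hy, ← hy']
    exact hs x y
  have h2 : ∀ p ∈ A.graph, ∀ q ∈ A.graph.topologicalClosure,
      inner ℂ p.2 q.1 = inner ℂ p.1 q.2 := by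
    intro p hp q hq
    have hc : _root_.IsClosed {q : F × F | inner ℂ p.2 q.1 = inner ℂ p.1 q.2} :=
      isClosed_eq (by fun_prop) (by fun_prop)
    exact closure_minimal (fun q hq => h1 p hp q hq) hc hq
  have hc : _root_.IsClosed {p : F × F | inner ℂ p.2 q.1 = inner ℂ p.1 q.2} :=
    isClosed_eq (by fun_prop) (by fun_prop)
  exact closure_minimal (fun p hp => h2 p hp q hq) hc hp

/-- A densely defined symmetric operator `A` with `A - E ≥ 1` is essentially self-adjoint as soon
as the range of `A - E` has trivial orthogonal complement. -/
theorem isEssentiallySelfAdjoint_of_coercive [CompleteSpace F] {A : F →ₗ.[ℂ] F} (hd : Dense (A.domain : Set F))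
    (hs : A.IsFormalAdjoint A) (E : ℝ)
    (hco : ∀ x : A.domain, ‖(x : F)‖ ^ 2 ≤ (inner ℂ (x : F) (A x - (E : ℂ) • (x : F))).re)
    (hker : ∀ ψ : F, (∀ x : A.domain, inner ℂ ψ (A x - (E : ℂ) • (x : F)) = 0) → ψ = 0) :
    IsEssentiallySelfAdjoint A := by
  have hle : A ≤ A.adjoint := hs.le_adjoint hd
  have hcl : A.IsClosable := (LinearPMap.adjoint_isClosed hd).isClosable.leIsClosable hle
  have hgr := hcl.graph_closure_eq_closure_graph
  have hdC : Dense (A.closure.domain : Set F) := hd.mono A.le_closure.1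
  refine ⟨hd, hs, hcl, ?_⟩
  rw [LinearPMap.isSelfAdjoint_def]
  apply LinearPMap.eq_of_eq_graph
  rw [LinearPMap.adjoint_graph_eq_graph_adjoint hdC, ← hgr]
  let R : A.domain →ₗ[ℂ] F := A.toFun - (E : ℂ) • A.domain.subtype
  have hRa : ∀ x, R x = A x - (E : ℂ) • (x : F) := fun x => rfl
  -- Cauchy–Schwarz turns the form bound into a norm bound, so preimages under R of a Cauchy
  -- sequence are Cauchy.
  have hlow : ∀ x : A.domain, ‖(x : F)‖ ≤ ‖R x‖ := by
    intro x
    have h1 := hco x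
    have h2 := (Complex.re_le_norm _).trans (norm_inner_le_norm (𝕜 := ℂ) (x : F) (R x))
    rw [← hRa] at h1
    rcases (norm_nonneg (x : F)).eq_or_lt with h0 | h0
    · rw [← h0]; exact norm_nonneg _
    · exact le_of_mul_le_mul_left (by nlinarith) h0
  have hRd : Dense (LinearMap.range R : Set F) := by
    rw [Submodule.dense_iff_topologicalClosure_eq_top,
      Submodule.topologicalClosure_eq_top_iff, Submodule.eq_bot_iff]
    intro ψ hψ
    refine hker ψ fun x => ?_
    rw [Submodule.mem_orthogonal'] at hψ
    exact hψ (R x) ⟨x, rfl⟩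
  ext ⟨x, x'⟩
  rw [Submodule.mem_adjoint_iff]
  constructor
  -- Approximate x' - E x along the dense range of A - E. The preimages converge to some y in the
  -- domain of the closure, and x - y is orthogonal to the range.
  · intro hx
    obtain ⟨w, hw, hlim⟩ := mem_closure_iff_seq_limit.1 (hRd (x' - (E : ℂ) • x))
    choose a ha using hw
    have hcau : CauchySeq (fun k => (a k : F)) := by
      have hc := hlim.cauchySeq
      rw [Metric.cauchySeq_iff'] at hc ⊢
      intro ε hε
      obtain ⟨N, hN⟩ := hc ε hε
      refine ⟨N, fun k hk => (hN k hk).trans_le' ?_⟩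
      rw [dist_eq_norm, dist_eq_norm, ← ha, ← ha, ← map_sub, ← Submodule.coe_sub]
      exact hlow _
    obtain ⟨y, hy⟩ := cauchySeq_tendsto_of_complete hcau
    have hA : Tendsto (fun k => A (a k)) atTop (𝓝 (x' - (E : ℂ) • x + (E : ℂ) • y)) := by
      refine (hlim.add (hy.const_smul (E : ℂ))).congr fun k => ?_
      rw [← ha, hRa, sub_add_cancel]
    have hmem : (y, x' - (E : ℂ) • x + (E : ℂ) • y) ∈ A.graph.topologicalClosure :=
      mem_closure_of_tendsto (hy.prodMk_nhds hA)
        (Eventually.of_forall fun k => LinearPMap.mem_graph A (a k))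
    have hxy : x - y = 0 := by
      refine hker _ fun z => ?_
      have hz : ((z : F), A z) ∈ A.graph.topologicalClosure :=
        subset_closure (LinearPMap.mem_graph A z)
      have h1 := hx _ _ hz
      have h2 := hs.inner_eq_of_mem_closure_graph hz hmem
      rw [inner_sub_right, inner_smul_right, ← inner_conj_symm _ (A z),
        ← inner_conj_symm _ (z : F), ← Complex.conj_ofReal E, ← map_mul, ← map_sub]
      rw [map_eq_zero]
      simp only [inner_sub_right, inner_add_right, inner_smul_right] at h1 h2 ⊢
      linear_combination h1 - h2
    obtain rfl := sub_eq_zero.1 hxy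
    simpa using hmem
  · intro hx a b hab
    exact sub_eq_zero.2 (hs.inner_eq_of_mem_closure_graph hab hx)

end FunctionalAnalysis

/-! ### Exterior balls and the distance to the complement. -/

section Geometry

/-- Every boundary point of `Ω` lies on a sphere of radius `ρ` whose open ball misses `Ω`. -/
def HasExteriorBalls {E : Type*} [PseudoMetricSpace E] (Ω : Set E) (ρ : ℝ) : Prop :=
  ∀ y ∈ frontier Ω, ∃ z, dist y z = ρ ∧ Disjoint (Metric.ball z ρ) Ω

section

variable {E : Type*} [NormedAddCommGroup E] [InnerProductSpace ℝ E]

/-- Expand ‖x - y - ρν‖² < ρ². Inside the ball the linear term along ν dominates a quadratic Taylor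
error once ρ is small. -/
theorem inner_lt_of_mem_ball_add_smul {x y ν : E} {ρ : ℝ} (hν : ‖ν‖ = 1) (hρ : 0 < ρ)
    (hx : x ∈ Metric.ball (y + ρ • ν) ρ) : ‖x - y‖ ^ 2 < 2 * ρ * inner ℝ (x - y) ν := by
  rw [Metric.mem_ball, dist_eq_norm, ← sub_sub] at hx
  have h := norm_sub_sq_real (x - y) (ρ • ν)
  have h2 : ‖x - y - ρ • ν‖ ^ 2 < ρ ^ 2 := by gcongr
  rw [norm_smul, hν, inner_smul_right, Real.norm_of_nonneg hρ.le] at h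
  nlinarith

/-- A `C²` function without critical point at `x₀` has exterior balls of all small radii at all
boundary points near `x₀` of its sublevel set. -/
theorem exists_exterior_ball_of_contDiffOn [CompleteSpace E] {Ω U : Set E} {r : E → ℝ} {x₀ : E}
    (hΩ : IsOpen Ω) (hU : IsOpen U) (hx₀ : x₀ ∈ U) (hr : ContDiffOn ℝ 2 r U)
    (hr' : fderiv ℝ r x₀ ≠ 0) (hΩU : Ω ∩ U = {x | x ∈ U ∧ r x < 0}) :
    ∃ W ∈ 𝓝 x₀, ∃ ρ₀ > 0, ∀ ρ, 0 < ρ → ρ ≤ ρ₀ → ∀ y ∈ W ∩ frontier Ω,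
      ∃ z, dist y z = ρ ∧ Disjoint (Metric.ball z ρ) Ω := by
  have hd1 : ContDiffAt ℝ 1 (fderiv ℝ r) x₀ :=
    (hr.contDiffAt (hU.mem_nhds hx₀)).fderiv_right (m := 1) (by norm_num)
  obtain ⟨M, T, hT, hlip⟩ := hd1.exists_lipschitzOnWith
  have hcont : ContinuousAt (fun x => ‖fderiv ℝ r x‖) x₀ := hd1.continuousAt.norm
  have hm : 0 < ‖fderiv ℝ r x₀‖ := norm_pos_iff.2 hr'
  set m := ‖fderiv ℝ r x₀‖ / 2 with hmdef
  have hm0 : 0 < m := by positivity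
  have hS : {x | m < ‖fderiv ℝ r x‖} ∈ 𝓝 x₀ :=
    hcont.eventually (lt_mem_nhds (by rw [hmdef]; linarith))
  obtain ⟨ε, hε, hball⟩ := Metric.mem_nhds_iff.1
    (inter_mem (inter_mem hT hS) (hU.mem_nhds hx₀))
  -- The ball lies within 2ρ ≤ ε/2 of y, hence in the region where the gradient is controlled. The
  -- second bound gives 2ρM < m; the + 1 avoids division by zero.
  refine ⟨Metric.ball x₀ (ε / 2), Metric.ball_mem_nhds _ (by positivity),
    min (ε / 4) (m / (2 * (M + 1))), by positivity, ?_⟩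
  rintro ρ hρ hρ' y ⟨hyW, hyF⟩
  have hyB : y ∈ Metric.ball x₀ ε := Metric.ball_subset_ball (by linarith) hyW
  have hyU : y ∈ U := (hball hyB).2
  have hry : r y = 0 := by
    apply le_antisymm
    · have hcl : y ∈ closure (Ω ∩ U) := by
        rw [mem_closure_iff_nhds]
        intro t ht
        have h2 := mem_closure_iff_nhds.1 hyF.1 (t ∩ U) (inter_mem ht (hU.mem_nhds hyU))
        obtain ⟨w, ⟨hw1, hw2⟩, hw3⟩ := h2
        exact ⟨w, hw1, hw3, hw2⟩
      have hcr : ContinuousWithinAt r (Ω ∩ U) y :=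
        (hr.continuousOn.continuousAt (hU.mem_nhds hyU)).continuousWithinAt
      have := hcr.mem_closure_image hcl
      have hsub : r '' (Ω ∩ U) ⊆ Iic 0 := by
        rintro _ ⟨w, hw, rfl⟩
        rw [hΩU] at hw
        exact hw.2.le
      exact closure_minimal hsub isClosed_Iic this
    · by_contra! hlt
      have : y ∈ Ω ∩ U := by rw [hΩU]; exact ⟨hyU, hlt⟩
      rw [frontier, hΩ.interior_eq] at hyF
      exact hyF.2 this.1
  have hmy : m < ‖fderiv ℝ r y‖ := (hball hyB).1.2
  set g := (InnerProductSpace.toDual ℝ E).symm (fderiv ℝ r y) with hg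
  have hgn : ‖g‖ = ‖fderiv ℝ r y‖ := LinearIsometryEquiv.norm_map _ _
  have hg0 : 0 < ‖g‖ := by rw [hgn]; linarith
  have hgi : ∀ v, fderiv ℝ r y v = inner ℝ g v := fun v => by
    rw [hg, InnerProductSpace.toDual_symm_apply]
  set ν := ‖g‖⁻¹ • g with hν
  have hν1 : ‖ν‖ = 1 := by rw [hν, norm_smul, norm_inv, norm_norm, inv_mul_cancel₀ hg0.ne']
  -- The centre lies in the direction of the gradient. A point x of Ω in the ball would have r x <
  -- 0, but Taylor's bound r x ≥ (m - 2ρM)⟨x - y, ν⟩ is positive.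
  refine ⟨y + ρ • ν, ?_, ?_⟩
  · rw [dist_eq_norm, sub_add_cancel_left, norm_neg, norm_smul, hν1, Real.norm_of_nonneg hρ.le,
      mul_one]
  rw [Set.disjoint_left]
  intro x hx hxΩ
  have hin := inner_lt_of_mem_ball_add_smul hν1 hρ hx
  have hxy : ‖x - y‖ ≤ 2 * ρ := by
    have h1 := real_inner_le_norm (x - y) ν
    rw [hν1, mul_one] at h1
    by_contra! hlt
    have h0 : 0 < ‖x - y‖ := by linarith
    have : ‖x - y‖ * ‖x - y‖ < 2 * ρ * ‖x - y‖ := by nlinarith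
    exact absurd (lt_of_mul_lt_mul_right this h0.le) (by linarith)
  have hρε : ρ ≤ ε / 4 := hρ'.trans (min_le_left _ _)
  have hρm : ρ ≤ m / (2 * (M + 1)) := hρ'.trans (min_le_right _ _)
  have hxB : x ∈ Metric.ball x₀ ε := by
    rw [Metric.mem_ball] at hyW ⊢
    have := dist_triangle x y x₀
    rw [dist_eq_norm x y] at this
    linarith
  have hseg : segment ℝ y x ⊆ Metric.ball x₀ ε := (convex_ball x₀ ε).segment_subset hyB hxB
  have htay : ‖r x - r y - fderiv ℝ r y (x - y)‖ ≤ M * ‖x - y‖ * ‖x - y‖ := by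
    refine (convex_segment y x).norm_image_sub_le_of_norm_fderiv_le' ?_ ?_
      (left_mem_segment ℝ y x) (right_mem_segment ℝ y x)
    · intro w hw
      exact (hr.contDiffAt (hU.mem_nhds (hball (hseg hw)).2)).differentiableAt two_ne_zero
    · intro w hw
      refine (hlip.norm_sub_le (hball (hseg hw)).1.1 (hball hyB).1.1).trans ?_
      gcongr
      rw [← dist_eq_norm, ← dist_eq_norm, dist_comm x y]
      rw [dist_comm w y]
      obtain ⟨t, ht, rfl⟩ := segment_eq_image' ℝ y x ▸ hw
      rw [dist_eq_norm, dist_eq_norm, sub_add_cancel_left, norm_neg, norm_smul,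
        Real.norm_of_nonneg ht.1, norm_sub_rev y x]
      exact mul_le_of_le_one_left (norm_nonneg _) ht.2
  have hxr : r x < 0 := by
    have : x ∈ Ω ∩ U := ⟨hxΩ, (hball hxB).2⟩
    rw [hΩU] at this
    exact this.2
  rw [hry, sub_zero, Real.norm_eq_abs, abs_le, hgi] at htay
  have hgν : inner ℝ g (x - y) = ‖g‖ * inner ℝ (x - y) ν := by
    rw [hν, inner_smul_right, real_inner_comm, mul_inv_cancel_left₀ hg0.ne']
  have hlow := htay.1
  rw [hgν] at hlow
  have hin0 : 0 < inner ℝ (x - y) ν := by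
    have := sq_nonneg ‖x - y‖
    by_contra! hneg
    nlinarith
  rw [le_div_iff₀ (by positivity)] at hρm
  have hMnn : (0 : ℝ) ≤ M := M.2
  have h3 : M * ‖x - y‖ * ‖x - y‖ ≤ M * (2 * ρ * inner ℝ (x - y) ν) := by
    rw [mul_assoc, ← sq]; gcongr
  have h4 : m * inner ℝ (x - y) ν ≤ ‖g‖ * inner ℝ (x - y) ν := by
    gcongr; rw [hgn]; exact hmy.le
  nlinarith [mul_le_mul_of_nonneg_right hρm hin0.le]

/-- The distance to the complement is semiconcave where exterior balls exist. -/
theorem infDist_compl_second_difference_le [FiniteDimensional ℝ E] {Ω : Set E} {ρ : ℝ}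
    (hρ : 0 < ρ) (hΩ : IsOpen Ω) (hne : Ω ≠ univ) (hball : HasExteriorBalls Ω ρ)
    {x w : E} (hx : x ∈ Ω) (hp : x + w ∈ Ω) (hm : x - w ∈ Ω) :
    Metric.infDist (x + w) Ωᶜ + Metric.infDist (x - w) Ωᶜ - 2 * Metric.infDist x Ωᶜ
      ≤ ‖w‖ ^ 2 / ρ := by
  -- Let z be the centre of an exterior ball touching at a nearest boundary point y. Then δ ≤ |· -
  -- z| - ρ on Ω, with equality at x, so the second difference of δ is at most that of |· - z|.
  obtain ⟨y, hy, hxy⟩ := exists_mem_frontier_infDist_compl_eq_dist hx hne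
  obtain ⟨z, hyz, hdis⟩ := hball y hy
  have hcb : Metric.closedBall z ρ ⊆ Ωᶜ := by
    rw [← closure_ball z hρ.ne']
    exact closure_minimal (fun p hp hpΩ => Set.disjoint_left.1 hdis hp hpΩ) hΩ.isClosed_compl
  have hfar : ∀ p ∈ Ω, ρ < ‖p - z‖ := by
    intro p hp
    by_contra! hle
    exact hcb (by rwa [Metric.mem_closedBall, dist_eq_norm]) hp
  have hup : ∀ p ∈ Ω, Metric.infDist p Ωᶜ ≤ ‖p - z‖ - ρ := by
    intro p hp
    have hpos : 0 < ‖p - z‖ := hρ.trans (hfar p hp)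
    have hq : z + (ρ / ‖p - z‖) • (p - z) ∈ Ωᶜ := by
      apply hcb
      rw [Metric.mem_closedBall, dist_eq_norm, add_sub_cancel_left, norm_smul, norm_div, norm_norm,
        Real.norm_of_nonneg hρ.le, div_mul_cancel₀ _ hpos.ne']
    refine (Metric.infDist_le_dist_of_mem hq).trans_eq ?_
    have : p - (z + (ρ / ‖p - z‖) • (p - z)) = (1 - ρ / ‖p - z‖) • (p - z) := by
      rw [sub_smul, one_smul]; abel
    rw [dist_eq_norm, this, norm_smul, Real.norm_of_nonneg]
    · field_simp
    · rw [sub_nonneg, div_le_one hpos]; exact (hfar p hp).le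
  have hlo : ‖x - z‖ - ρ ≤ Metric.infDist x Ωᶜ := by
    rw [hxy, ← hyz, ← dist_eq_norm]
    linarith [dist_triangle x y z]
  have h1 := hup _ hp
  have h2 := hup _ hm
  rw [add_sub_right_comm] at h1
  rw [sub_right_comm] at h2
  set q := x - z
  have hq : ρ < ‖q‖ := hfar x hx
  have hpar := parallelogram_law_with_norm ℝ q w
  -- From (α + β)² ≤ 2(α² + β²) and the parallelogram law.
  have hk : ‖q + w‖ + ‖q - w‖ ≤ 2 * ‖q‖ + ‖w‖ ^ 2 / ‖q‖ := by
    have hq0 : 0 < ‖q‖ := hρ.trans hq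
    rw [← pow_le_pow_iff_left₀ (by positivity) (by positivity) two_ne_zero]
    have : (2 * ‖q‖ + ‖w‖ ^ 2 / ‖q‖) ^ 2
        = 4 * ‖q‖ ^ 2 + 4 * ‖w‖ ^ 2 + (‖w‖ ^ 2 / ‖q‖) ^ 2 := by
      field_simp; ring
    rw [this]
    nlinarith [sq_nonneg (‖q + w‖ - ‖q - w‖), sq_nonneg (‖w‖ ^ 2 / ‖q‖)]
  have hl : ‖w‖ ^ 2 / ‖q‖ ≤ ‖w‖ ^ 2 / ρ := by gcongr
  linarith

/-- The distance is 1-Lipschitz, and it decreases at unit speed along the segment to a nearest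
boundary point; the one-sided derivative there determines the slope. -/
theorem norm_fderiv_infDist_compl_eq_one [FiniteDimensional ℝ E] {Ω : Set E}
    (hΩ : IsOpen Ω) (hne : Ω ≠ univ) {x : E} (hx : x ∈ Ω)
    (hd : DifferentiableAt ℝ (fun y => Metric.infDist y Ωᶜ) x) :
    ‖fderiv ℝ (fun y => Metric.infDist y Ωᶜ) x‖ = 1 := by
  set δ := fun y => Metric.infDist y Ωᶜ with hδ
  apply le_antisymm
  · simpa using norm_fderiv_le_of_lipschitz ℝ (x₀ := x) (Metric.lipschitz_infDist_pt Ωᶜ)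
  obtain ⟨y, hy, hxy⟩ := exists_mem_frontier_infDist_compl_eq_dist hx hne
  have hyc : y ∈ Ωᶜ := fun h => by
    rw [frontier, hΩ.interior_eq] at hy; exact hy.2 h
  have hpos : 0 < ‖y - x‖ := norm_pos_iff.2 (sub_ne_zero.2 fun h => hyc (h ▸ hx))
  have hline := (hd.hasFDerivAt.hasLineDerivAt (y - x))
  have hder : HasDerivWithinAt (fun t : ℝ => δ (x + t • (y - x)))
      (fderiv ℝ δ x (y - x)) (Ici 0) 0 := HasDerivAt.hasDerivWithinAt hline
  have hder2 : HasDerivWithinAt (fun t : ℝ => δ (x + t • (y - x))) (-‖y - x‖) (Ici 0) 0 := by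
    have hlin : HasDerivWithinAt (fun t : ℝ => (1 - t) * ‖y - x‖) (-‖y - x‖) (Ici 0) 0 := by
      simpa using (((hasDerivAt_id (0 : ℝ)).const_sub 1).mul_const ‖y - x‖).hasDerivWithinAt
    refine hlin.congr_of_eventuallyEq ?_ ?_
    · have : Icc (0 : ℝ) 1 ∈ 𝓝[≥] 0 := Icc_mem_nhdsGE zero_lt_one
      filter_upwards [this] with t ht
      apply le_antisymm
      · refine (Metric.infDist_le_dist_of_mem hyc).trans_eq ?_
        have : x + t • (y - x) - y = -((1 - t) • (y - x)) := by
          rw [sub_smul, one_smul]; abel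
        rw [dist_eq_norm, this, norm_neg, norm_smul, Real.norm_of_nonneg (by linarith [ht.2])]
      · have h1 : Metric.infDist x Ωᶜ ≤ Metric.infDist (x + t • (y - x)) Ωᶜ
          + dist x (x + t • (y - x)) := Metric.infDist_le_infDist_add_dist
        rw [hxy, dist_eq_norm x y, norm_sub_rev, dist_eq_norm, sub_add_cancel_left, norm_neg,
          norm_smul, Real.norm_of_nonneg ht.1] at h1
        change _ ≤ Metric.infDist _ _
        linarith
    · simp only [hδ, zero_smul, add_zero, hxy]
      rw [dist_eq_norm, norm_sub_rev]; ring
  have heq := (uniqueDiffWithinAt_Ici (0 : ℝ)).eq_deriv _ hder hder2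
  have hle := (fderiv ℝ δ x).le_opNorm (y - x)
  rw [heq, norm_neg, norm_norm] at hle
  exact le_of_mul_le_mul_right (by rwa [one_mul]) hpos

end

/-- Compactness of the boundary makes the local radii uniform. The induction carries every radius up
to a bound, so that two pieces can share the smaller bound. -/
theorem HasC2Boundary.exists_hasExteriorBalls {n : ℕ} {Ω : Opens (EuclideanSpace ℝ (Fin n))}
    (hbdd : Bornology.IsBounded (Ω : Set (EuclideanSpace ℝ (Fin n)))) (h : HasC2Boundary Ω) :
    ∃ ρ > 0, HasExteriorBalls (Ω : Set (EuclideanSpace ℝ (Fin n))) ρ := by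
  have hcomp : IsCompact (frontier (Ω : Set (EuclideanSpace ℝ (Fin n)))) :=
    Metric.isCompact_of_isClosed_isBounded isClosed_frontier
      (hbdd.closure.subset frontier_subset_closure)
  have key := hcomp.induction_on
    (p := fun S => ∃ ρ₀ > 0, ∀ ρ, 0 < ρ → ρ ≤ ρ₀ →
      ∀ y ∈ S ∩ frontier (Ω : Set (EuclideanSpace ℝ (Fin n))),
        ∃ z, dist y z = ρ ∧ Disjoint (Metric.ball z ρ) (Ω : Set (EuclideanSpace ℝ (Fin n))))
    ⟨1, one_pos, by simp⟩ ?_ ?_ ?_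
  · obtain ⟨ρ₀, hρ₀, hall⟩ := key
    exact ⟨ρ₀, hρ₀, fun y hy => hall ρ₀ hρ₀ le_rfl y ⟨hy, hy⟩⟩
  · rintro S T hST ⟨ρ₀, hρ₀, hall⟩
    exact ⟨ρ₀, hρ₀, fun ρ h1 h2 y hy => hall ρ h1 h2 y ⟨hST hy.1, hy.2⟩⟩
  · rintro S T ⟨ρ₁, hρ₁, h1⟩ ⟨ρ₂, hρ₂, h2⟩
    refine ⟨min ρ₁ ρ₂, lt_min hρ₁ hρ₂, ?_⟩
    rintro ρ hρ hle y ⟨hy | hy, hyF⟩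
    · exact h1 ρ hρ (hle.trans (min_le_left _ _)) y ⟨hy, hyF⟩
    · exact h2 ρ hρ (hle.trans (min_le_right _ _)) y ⟨hy, hyF⟩
  · intro x hx
    obtain ⟨U, r, hU, hxU, hr, hr', hΩU⟩ := h x hx
    obtain ⟨W, hW, ρ₀, hρ₀, hall⟩ :=
      exists_exterior_ball_of_contDiffOn Ω.isOpen hU hxU hr (hr' x hxU) hΩU
    exact ⟨W, mem_nhdsWithin_of_mem_nhds hW, ρ₀, hρ₀, hall⟩

/-- A nearest point of the complement lies on the boundary. The distance to the complement is more
convenient because it vanishes off Ω. -/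
theorem bdryDist_eq_infDist_compl {n : ℕ} {Ω : Opens (EuclideanSpace ℝ (Fin n))}
    (hne : (Ω : Set (EuclideanSpace ℝ (Fin n))) ≠ univ) {x : EuclideanSpace ℝ (Fin n)}
    (hx : x ∈ Ω) :
    bdryDist Ω x = Metric.infDist x (Ω : Set (EuclideanSpace ℝ (Fin n)))ᶜ := by
  obtain ⟨y, hy, hxy⟩ := exists_mem_frontier_infDist_compl_eq_dist hx hne
  apply le_antisymm
  · rw [hxy]; exact Metric.infDist_le_dist_of_mem hy
  · refine Metric.infDist_le_infDist_of_subset ?_ ⟨y, hy⟩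
    intro z hz hzΩ
    rw [frontier, Ω.isOpen.interior_eq] at hz
    exact hz.2 hzΩ

end Geometry

/-! ### Lipschitz functions and weak bounds on second derivatives. -/

section LipschitzCalculus

/-- Bounded Lipschitz real functions. -/
def IsBoundedLipschitz {E : Type*} [PseudoMetricSpace E] (f : E → ℝ) : Prop :=
  (∃ C, LipschitzWith C f) ∧ ∃ B, ∀ x, |f x| ≤ B

theorem IsBoundedLipschitz.mul {E : Type*} [PseudoMetricSpace E] {f g : E → ℝ}
    (hf : IsBoundedLipschitz f) (hg : IsBoundedLipschitz g) :
    IsBoundedLipschitz (fun x => f x * g x) := by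
  obtain ⟨⟨C, hC⟩, A, hA⟩ := hf
  obtain ⟨⟨D, hD⟩, B, hB⟩ := hg
  refine ⟨⟨Real.toNNReal (|A| * D + |B| * C), LipschitzWith.of_dist_le_mul fun x y => ?_⟩,
    |A| * |B|, fun x => ?_⟩
  · rw [Real.coe_toNNReal _ (by positivity), Real.dist_eq]
    have h1 := hC.dist_le_mul x y
    have h2 := hD.dist_le_mul x y
    rw [Real.dist_eq] at h1 h2
    calc |f x * g x - f y * g y| = |f x * (g x - g y) + g y * (f x - f y)| := by ring_nf
      _ ≤ |f x * (g x - g y)| + |g y * (f x - f y)| := abs_add_le _ _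
      _ = |f x| * |g x - g y| + |g y| * |f x - f y| := by rw [abs_mul, abs_mul]
      _ ≤ |A| * (D * dist x y) + |B| * (C * dist x y) :=
          add_le_add
            (mul_le_mul ((hA x).trans (le_abs_self A)) h2 (abs_nonneg _) (abs_nonneg _))
            (mul_le_mul ((hB y).trans (le_abs_self B)) h1 (abs_nonneg _) (abs_nonneg _))
      _ = _ := by ring
  · rw [abs_mul]
    exact mul_le_mul ((hA x).trans (le_abs_self A)) ((hB x).trans (le_abs_self B))
      (abs_nonneg _) (abs_nonneg _)

theorem LipschitzWith.isBoundedLipschitz_of_hasCompactSupport {E : Type*} [PseudoMetricSpace E]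
    {C : NNReal} {f : E → ℝ} (hf : LipschitzWith C f) (hc : HasCompactSupport f) :
    IsBoundedLipschitz f :=
  ⟨⟨C, hf⟩, by simpa using hc.exists_bound_of_continuous hf.continuous⟩

variable {E : Type*} [NormedAddCommGroup E] [NormedSpace ℝ E]

theorem lineDeriv_eq_zero_of_notMem_tsupport {f : E → ℝ} {x : E} (hx : x ∉ tsupport f) (v : E) :
    lineDeriv ℝ f x v = 0 := by
  have h : f =ᶠ[𝓝 x] fun _ => 0 := notMem_tsupport_iff_eventuallyEq.1 hx
  rw [h.lineDeriv_eq]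
  simp [lineDeriv]

variable [MeasurableSpace E] [BorelSpace E] [FiniteDimensional ℝ E]
  {μ : Measure E} [μ.IsAddHaarMeasure]

theorem LipschitzWith.integrable_lineDeriv {C : NNReal} {f : E → ℝ} (hf : LipschitzWith C f)
    (hc : HasCompactSupport f) (v : E) : Integrable (fun x => lineDeriv ℝ f x v) μ := by
  have h := (hf.locallyIntegrable_lineDeriv (μ := μ) v).integrableOn_isCompact hc
  exact (integrableOn_iff_integrable_of_support_subset fun x hx => by
    by_contra hn
    exact hx (lineDeriv_eq_zero_of_notMem_tsupport hn v)).1 h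

theorem LipschitzWith.integrable_lineDeriv_mul {C D : NNReal} {f g : E → ℝ}
    (hf : LipschitzWith C f) (hg : LipschitzWith D g) (hc : HasCompactSupport g) (v w : E) :
    Integrable (fun x => lineDeriv ℝ f x v * lineDeriv ℝ g x w) μ :=
  (hg.integrable_lineDeriv hc w).bdd_mul (aestronglyMeasurable_lineDeriv hf.continuous μ)
    (Eventually.of_forall fun _ => norm_lineDeriv_le_of_lipschitz ℝ hf)

/-- Second differences of `δ` bounded above by `κ t²` give `∂ᵥ∂ᵥδ ≤ κ` in the weak sense. -/
theorem neg_mul_integral_le_integral_lineDeriv_mul_lineDeriv {C D : NNReal} {δ η : E → ℝ}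
    (hδ : LipschitzWith C δ) (hη : LipschitzWith D η) (hc : HasCompactSupport η)
    (hη0 : ∀ x, 0 ≤ η x) (v : E) (κ : ℝ)
    (hsc : ∀ᶠ t in 𝓝[>] (0 : ℝ), ∀ x ∈ tsupport η,
      δ (x + t • v) + δ (x - t • v) - 2 * δ x ≤ κ * t ^ 2) :
    -κ * ∫ x, η x ∂μ ≤ ∫ x, lineDeriv ℝ δ x v * lineDeriv ℝ η x v ∂μ := by
  have hηi : Integrable η μ := hη.continuous.integrable_of_hasCompactSupport hc
  have hcδ := hδ.continuous
  have hcη := hη.continuous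
  -- Contains the supports of η and of x ↦ η(x + t v) for 0 < t ≤ 1, so the difference quotients are
  -- dominated by one integrable function; they converge almost everywhere by Rademacher's theorem.
  let K := Metric.cthickening ‖v‖ (tsupport η)
  have hK : IsCompact K := IsCompact.cthickening hc
  have hlim : Tendsto (fun t : ℝ => ∫ x, (t⁻¹ • (δ (x + t • v) - δ x)) *
      (t⁻¹ • (η (x + t • v) - η x)) ∂μ) (𝓝[>] 0)
      (𝓝 (∫ x, lineDeriv ℝ δ x v * lineDeriv ℝ η x v ∂μ)) := by
    apply tendsto_integral_filter_of_dominated_convergence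
      (K.indicator (fun _ => (C * ‖v‖) * (D * ‖v‖)))
    · exact Eventually.of_forall fun t => Continuous.aestronglyMeasurable (by fun_prop)
    · filter_upwards [Ioc_mem_nhdsGT zero_lt_one] with t ht
      have htp : 0 < t := ht.1
      refine Eventually.of_forall fun x => ?_
      have hq : ∀ {f : E → ℝ} {L : NNReal}, LipschitzWith L f →
          ‖t⁻¹ • (f (x + t • v) - f x)‖ ≤ L * ‖v‖ := by
        intro f L hf
        have h := hf.norm_sub_le (x + t • v) x
        rw [add_sub_cancel_left, norm_smul, Real.norm_of_nonneg htp.le] at h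
        rw [norm_smul, norm_inv, Real.norm_of_nonneg htp.le, inv_mul_le_iff₀ htp]
        linarith
      by_cases hx : x ∈ K
      · rw [indicator_of_mem hx, norm_mul]
        exact mul_le_mul (hq hδ) (hq hη) (norm_nonneg _) (by positivity)
      · have hA : η x = 0 := by
          by_contra h
          exact hx (Metric.self_subset_cthickening _ (subset_tsupport _ h))
        have hB : η (x + t • v) = 0 := by
          by_contra h
          refine hx (Metric.mem_cthickening_of_dist_le _ _ _ _ (subset_tsupport _ h) ?_)
          rw [dist_eq_norm, sub_add_cancel_left, norm_neg, norm_smul, Real.norm_of_nonneg htp.le]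
          exact mul_le_of_le_one_left (norm_nonneg v) ht.2
        rw [hA, hB, indicator_of_notMem hx]
        simp
    · rw [integrable_indicator_iff hK.measurableSet]
      exact continuousOn_const.integrableOn_compact hK
    · filter_upwards [hδ.ae_lineDifferentiableAt (μ := μ) v,
        hη.ae_lineDifferentiableAt (μ := μ) v] with x h1 h2
      exact h1.hasLineDerivAt.tendsto_slope_zero_right.mul
        h2.hasLineDerivAt.tendsto_slope_zero_right
  refine ge_of_tendsto hlim ?_
  filter_upwards [hsc, self_mem_nhdsWithin] with t ht (htp : 0 < t)
  -- Discrete integration by parts: translating one factor turns the product of increments into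
  -- minus the second difference of δ times η.
  let a : E → ℝ := fun x => δ (x + t • v) - δ x
  have hca : Continuous a := by fun_prop
  have hshift : ∫ x, a x * η (x + t • v) ∂μ = ∫ x, a (x - t • v) * η x ∂μ := by
    rw [← integral_sub_right_eq_self _ (t • v)]
    simp
  have hi1 : Integrable (fun x => a (x - t • v) * η x) μ :=
    Continuous.integrable_of_hasCompactSupport (by fun_prop) hc.mul_left
  have hi2 : Integrable (fun x => a x * η x) μ :=
    Continuous.integrable_of_hasCompactSupport (by fun_prop) hc.mul_left
  have hi3 : Integrable (fun x => a x * η (x + t • v)) μ := by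
    refine Continuous.integrable_of_hasCompactSupport (by fun_prop) ?_
    exact (hc.comp_homeomorph (Homeomorph.addRight (t • v))).mul_left
  have heq : ∫ x, (t⁻¹ • (δ (x + t • v) - δ x)) * (t⁻¹ • (η (x + t • v) - η x)) ∂μ
      = (t ^ 2)⁻¹ * ∫ x, (a (x - t • v) - a x) * η x ∂μ := by
    simp_rw [sub_mul]
    rw [integral_sub hi1 hi2, ← hshift, ← integral_sub hi3 hi2, ← integral_const_mul]
    congr 1
    funext x
    simp only [a, smul_eq_mul]
    field_simp
  have hle : ∫ x, (-κ * t ^ 2) * η x ∂μ ≤ ∫ x, (a (x - t • v) - a x) * η x ∂μ := by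
    have hi : Integrable (fun x => (a (x - t • v) - a x) * η x) μ := by
      simp only [sub_mul]
      exact hi1.sub hi2
    refine integral_mono (hηi.const_mul _) hi fun x => ?_
    by_cases hx : x ∈ tsupport η
    · have h := ht x hx
      have : -κ * t ^ 2 ≤ a (x - t • v) - a x := by
        simp only [a, sub_add_cancel]
        linarith
      exact mul_le_mul_of_nonneg_right this (hη0 x)
    · simp [image_eq_zero_of_notMem_tsupport hx]
  rw [heq, ← div_eq_inv_mul, le_div_iff₀ (by positivity)]
  rw [integral_const_mul] at hle
  linarith

end LipschitzCalculus

/-! ### Hardy's inequality with constant 1/4. -/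

section Hardy

/-- The weight is the logarithmic derivative of √(t/(1 + Kt)), which composed with δ is the positive
supersolution behind Hardy's inequality. -/
theorem hasDerivAt_hardyWeight {K t : ℝ} (hK : 0 ≤ K) (ht : 0 < t) :
    HasDerivAt (fun t : ℝ => 1 / (2 * t) - K / (2 * (1 + K * t)))
      (-1 / (2 * t ^ 2) + K ^ 2 / (2 * (1 + K * t) ^ 2)) t := by
  have hp : (0 : ℝ) < 1 + K * t := by positivity
  have h1 : HasDerivAt (fun t : ℝ => 2 * t) 2 t := by simpa using (hasDerivAt_id t).const_mul 2
  have h2 : HasDerivAt (fun t : ℝ => 2 * (1 + K * t)) (2 * K) t := by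
    simpa using (((hasDerivAt_id t).const_mul K).const_add 1).const_mul 2
  have := ((hasDerivAt_const t (1 : ℝ)).div h1 (by positivity)).sub
    ((hasDerivAt_const t K).div h2 (by positivity))
  refine this.congr_deriv ?_
  field_simp
  ring

/-- With a = K/(1 + Kt) the right side is exactly 1/(4t²) - 3a²/4, and a ≤ K. At t = δ it is the
lower bound for -Δφ/φ, φ = √(δ/(1 + Kδ)), that results from |∇δ| = 1 and Δδ ≤ K. -/
theorem hardyWeight_riccati {K t : ℝ} (hK : 0 ≤ K) (ht : 0 < t) :
    1 / 4 * (1 / t ^ 2) - 3 / 4 * K ^ 2 ≤ -(-1 / (2 * t ^ 2) + K ^ 2 / (2 * (1 + K * t) ^ 2))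
      - (1 / (2 * t) - K / (2 * (1 + K * t))) ^ 2
      - K * (1 / (2 * t) - K / (2 * (1 + K * t))) := by
  have hp : (0 : ℝ) < 1 + K * t := by positivity
  have h1 : -(-1 / (2 * t ^ 2) + K ^ 2 / (2 * (1 + K * t) ^ 2))
      - (1 / (2 * t) - K / (2 * (1 + K * t))) ^ 2
      - K * (1 / (2 * t) - K / (2 * (1 + K * t)))
      = 1 / 4 * (1 / t ^ 2) - 3 / 4 * (K / (1 + K * t)) ^ 2 := by
    field_simp
    ring
  rw [h1]
  have h2 : K / (1 + K * t) ≤ K := div_le_self hK (by nlinarith [mul_nonneg hK ht.le])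
  have h3 : 0 ≤ K / (1 + K * t) := by positivity
  nlinarith

/-- The one-sided bound on Δδ can only be tested against nonnegative functions. -/
theorem hardyWeight_nonneg {K t : ℝ} (hK : 0 ≤ K) (ht : 0 < t) :
    0 ≤ 1 / (2 * t) - K / (2 * (1 + K * t)) := by
  have hp : (0 : ℝ) < 1 + K * t := by positivity
  have : 1 / (2 * t) - K / (2 * (1 + K * t)) = 1 / (2 * t * (1 + K * t)) := by
    field_simp; ring
  rw [this]; positivity

/-- Truncation at s removes the singularity at the boundary and is inactive where s ≤ δ, in
particular on a given compact subset of Ω if s is small. -/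
theorem isBoundedLipschitz_hardyWeight_comp_max {E : Type*} [PseudoMetricSpace E] {C : NNReal}
    {δ : E → ℝ} (hδ : LipschitzWith C δ) {K s : ℝ} (hK : 0 ≤ K) (hs : 0 < s) :
    IsBoundedLipschitz
      (fun x => 1 / (2 * max (δ x) s) - K / (2 * (1 + K * max (δ x) s))) := by
  have hm : LipschitzWith C (fun x => max (δ x) s) := hδ.max_const s
  refine ⟨⟨Real.toNNReal (1 / s ^ 2 + K ^ 2) * C, LipschitzWith.of_dist_le_mul fun x y => ?_⟩,
    1 / (2 * s), fun x => ?_⟩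
  · have h := hm.dist_le_mul x y
    rw [Real.dist_eq] at h ⊢
    set a := max (δ x) s
    set b := max (δ y) s
    have ha : s ≤ a := le_max_right _ _
    have hb : s ≤ b := le_max_right _ _
    have ha0 : 0 < a := hs.trans_le ha
    have hb0 : 0 < b := hs.trans_le hb
    have hKa : 1 ≤ 1 + K * a := by nlinarith [mul_nonneg hK ha0.le]
    have hKb : 1 ≤ 1 + K * b := by nlinarith [mul_nonneg hK hb0.le]
    have hKa0 : 0 < 1 + K * a := by linarith
    have hKb0 : 0 < 1 + K * b := by linarith
    have e : 1 / (2 * a) - K / (2 * (1 + K * a)) - (1 / (2 * b) - K / (2 * (1 + K * b)))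
        = (-(1 / (2 * (a * b))) + K ^ 2 / (2 * ((1 + K * a) * (1 + K * b)))) * (a - b) := by
      field_simp; ring
    rw [e, abs_mul, NNReal.coe_mul, Real.coe_toNNReal _ (by positivity), mul_assoc]
    refine mul_le_mul ?_ h (abs_nonneg _) (by positivity)
    have h1 : 1 / (2 * (a * b)) ≤ 1 / s ^ 2 := by
      apply one_div_le_one_div_of_le (by positivity)
      nlinarith [mul_le_mul ha hb hs.le ha0.le, mul_pos ha0 hb0]
    have h2 : K ^ 2 / (2 * ((1 + K * a) * (1 + K * b))) ≤ K ^ 2 := by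
      apply div_le_self (sq_nonneg K)
      nlinarith
    have h3 : 0 ≤ 1 / (2 * (a * b)) := by positivity
    have h4 : 0 ≤ K ^ 2 / (2 * ((1 + K * a) * (1 + K * b))) := by positivity
    rw [abs_le]
    constructor <;> nlinarith [sq_nonneg K, one_div_pos.2 (pow_pos hs 2)]
  · have ha : s ≤ max (δ x) s := le_max_right _ _
    have ha0 := hs.trans_le ha
    rw [abs_of_nonneg (hardyWeight_nonneg hK ha0)]
    have h1 : 1 / (2 * max (δ x) s) ≤ 1 / (2 * s) :=
      one_div_le_one_div_of_le (by positivity) (by linarith)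
    have h2 : 0 ≤ K / (2 * (1 + K * max (δ x) s)) := by positivity
    linarith

theorem exists_pos_lt_infDist_compl {E : Type*} [PseudoMetricSpace E] {Ω S : Set E}
    (hΩ : IsOpen Ω) (hne : Ω ≠ univ) (hS : IsCompact S) (hSΩ : S ⊆ Ω) :
    ∃ s > 0, ∀ x ∈ S, s < Metric.infDist x Ωᶜ := by
  have hpos : ∀ x ∈ S, 0 < Metric.infDist x Ωᶜ := fun x hx =>
    (hΩ.isClosed_compl.notMem_iff_infDist_pos (nonempty_compl.2 hne)).1 (not_not.2 (hSΩ hx))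
  rcases S.eq_empty_or_nonempty with rfl | hne'
  · exact ⟨1, one_pos, by simp⟩
  obtain ⟨y, hy, hmin⟩ := hS.exists_isMinOn hne' (Metric.continuous_infDist_pt Ωᶜ).continuousOn
  exact ⟨Metric.infDist y Ωᶜ / 2, half_pos (hpos y hy), fun x hx =>
    (half_lt_self (hpos y hy)).trans_le (hmin hx)⟩

theorem OrthonormalBasis.sum_apply_sq_eq_norm_sq {ι E : Type*} [Fintype ι] [NormedAddCommGroup E]
    [InnerProductSpace ℝ E] [CompleteSpace E] (b : OrthonormalBasis ι ℝ E) (l : E →L[ℝ] ℝ) :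
    ∑ i, l (b i) ^ 2 = ‖l‖ ^ 2 := by
  have h := b.sum_sq_norm_inner_left ((InnerProductSpace.toDual ℝ E).symm l)
  simpa [InnerProductSpace.toDual_symm_apply] using h

theorem laplacian_eq_sum_lineDeriv {ι E : Type*} [Fintype ι]
    [NormedAddCommGroup E] [InnerProductSpace ℝ E] [FiniteDimensional ℝ E]
    (b : OrthonormalBasis ι ℝ E) {u : E → ℝ} (hu : ContDiff ℝ 2 u)
    (x : E) : Laplacian.laplacian u x =
      ∑ i, lineDeriv ℝ (fun y => lineDeriv ℝ u y (b i)) x (b i) := by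
  rw [InnerProductSpace.laplacian_eq_iteratedFDeriv_orthonormalBasis u b]
  refine Finset.sum_congr rfl fun i _ => ?_
  have h1 : (fun y => lineDeriv ℝ u y (b i)) = fun y => fderiv ℝ u y (b i) := by
    funext y
    exact (hu.differentiable two_ne_zero y).lineDeriv_eq_fderiv
  have h2 : DifferentiableAt ℝ (fderiv ℝ u) x :=
    (hu.fderiv_right (m := 1) (by norm_num)).differentiable one_ne_zero x
  rw [h1, iteratedFDeriv_two_apply]
  refine ((h2.hasFDerivAt.clm_apply (hasFDerivAt_const (b i) x)).hasLineDerivAt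
    (b i)).lineDeriv.symm ▸ ?_
  simp

theorem ContDiff.exists_lipschitzWith_lineDeriv {E : Type*} [NormedAddCommGroup E]
    [NormedSpace ℝ E] {u : E → ℝ} (hu : ContDiff ℝ 2 u)
    (hc : HasCompactSupport u) (v : E) :
    ∃ C, LipschitzWith C (fun y => lineDeriv ℝ u y v) := by
  have h1 : (fun y => lineDeriv ℝ u y v) = fun y => fderiv ℝ u y v := by
    funext y
    exact (hu.differentiable two_ne_zero y).lineDeriv_eq_fderiv
  rw [h1]
  have h2 : ContDiff ℝ 1 (fun y => fderiv ℝ u y v) :=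
    (hu.fderiv_right (m := 1) (by norm_num)).clm_apply contDiff_const
  exact h2.lipschitzWith_of_hasCompactSupport (hc.fderiv_apply ℝ v) (by simp)

variable {ι E : Type*} [Fintype ι] [NormedAddCommGroup E] [InnerProductSpace ℝ E]
  [FiniteDimensional ℝ E] [MeasurableSpace E] [BorelSpace E]

/-- Weak upper bound on the Laplacian of the distance to the complement. -/
theorem neg_mul_integral_le_integral_sum_lineDeriv_infDist {Ω : Set E} {ρ : ℝ}
    (hρ : 0 < ρ) (hΩ : IsOpen Ω) (hne : Ω ≠ univ) (hball : HasExteriorBalls Ω ρ)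
    (b : OrthonormalBasis ι ℝ E) {D : NNReal} {η : E → ℝ} (hη : LipschitzWith D η)
    (hc : HasCompactSupport η) (hsupp : tsupport η ⊆ Ω) (hη0 : ∀ x, 0 ≤ η x) :
    -(Fintype.card ι / ρ) * ∫ x, η x ≤
      ∫ x, ∑ i, lineDeriv ℝ (fun y => Metric.infDist y Ωᶜ) x (b i) * lineDeriv ℝ η x (b i) := by
  have hδ := Metric.lipschitz_infDist_pt Ωᶜ
  rw [integral_finsetSum _ fun i _ => hδ.integrable_lineDeriv_mul hη hc _ _]
  -- Each unit direction contributes 1/ρ, and summation gives the constant card ι / ρ. Steps t ≤ s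
  -- from the support of η stay in Ω.
  have hterm : ∀ i, -(1 / ρ) * ∫ x, η x ≤
      ∫ x, lineDeriv ℝ (fun y => Metric.infDist y Ωᶜ) x (b i) * lineDeriv ℝ η x (b i) := by
    intro i
    refine neg_mul_integral_le_integral_lineDeriv_mul_lineDeriv hδ hη hc hη0 (b i) (1 / ρ) ?_
    obtain ⟨s, hs, hlt⟩ := exists_pos_lt_infDist_compl hΩ hne hc hsupp
    filter_upwards [Ioc_mem_nhdsGT hs] with t ht x hx
    have hn : ‖t • b i‖ = t := by
      rw [norm_smul, b.norm_eq_one, mul_one, Real.norm_of_nonneg ht.1.le]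
    have hsub : Metric.ball x (Metric.infDist x Ωᶜ) ⊆ Ω := Metric.ball_infDist_compl_subset
    have h := infDist_compl_second_difference_le hρ hΩ hne hball (hsupp hx)
      (w := t • b i) (hsub ?_) (hsub ?_)
    · rw [hn] at h
      exact h.trans_eq (by ring)
    · rw [Metric.mem_ball, dist_eq_norm, add_sub_cancel_left, hn]
      exact ht.2.trans_lt (hlt x hx)
    · rw [Metric.mem_ball, dist_eq_norm, sub_sub_cancel_left, norm_neg, hn]
      exact ht.2.trans_lt (hlt x hx)
  have := Finset.sum_le_sum fun i (_ : i ∈ Finset.univ) => hterm i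
  rw [Finset.sum_const, Finset.card_univ, nsmul_eq_mul] at this
  refine this.trans_eq' ?_
  ring

/-- Hardy's inequality with optimal constant on an open set with uniform exterior balls. -/
theorem hardy_inequality {Ω : Set E} {ρ : ℝ}
    (hρ : 0 < ρ) (hΩ : IsOpen Ω) (hne : Ω ≠ univ) (hball : HasExteriorBalls Ω ρ)
    (b : OrthonormalBasis ι ℝ E) {D : NNReal} {g : E → ℝ} (hg : LipschitzWith D g)
    (hc : HasCompactSupport g) (hsupp : tsupport g ⊆ Ω) :
    ∫ x, (1 / 4 * (1 / Metric.infDist x Ωᶜ ^ 2) - 3 / 4 * (Fintype.card ι / ρ) ^ 2) * g x ^ 2 ≤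
      ∫ x, ∑ i, lineDeriv ℝ g x (b i) ^ 2 := by
  set K : ℝ := Fintype.card ι / ρ with hKdef
  have hK : 0 ≤ K := by positivity
  set δ : E → ℝ := fun y => Metric.infDist y Ωᶜ with hδdef
  have hδ : LipschitzWith 1 δ := Metric.lipschitz_infDist_pt Ωᶜ
  obtain ⟨s, hs, hlt⟩ := exists_pos_lt_infDist_compl hΩ hne hc hsupp
  set h : ℝ → ℝ := fun t => 1 / (2 * t) - K / (2 * (1 + K * t)) with hh
  set η : E → ℝ := fun x => g x * g x * h (max (δ x) s) with hηdef
  have hgb := hg.isBoundedLipschitz_of_hasCompactSupport hc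
  obtain ⟨⟨D', hη⟩, -⟩ : IsBoundedLipschitz η :=
    (hgb.mul hgb).mul (isBoundedLipschitz_hardyWeight_comp_max hδ hK hs)
  have hηc : HasCompactSupport η := (hc.mul_left (f := g)).mul_right
  have hηs : tsupport η ⊆ tsupport g :=
    (closure_mono fun x hx => by
      simp only [hηdef, Function.mem_support, ne_eq, mul_eq_zero, not_or] at hx ⊢
      exact hx.1.1)
  have hη0 : ∀ x, 0 ≤ η x := fun x =>
    mul_nonneg (mul_self_nonneg _) (hardyWeight_nonneg hK (hs.trans_le (le_max_right _ _)))
  have hweak := neg_mul_integral_le_integral_sum_lineDeriv_infDist hρ hΩ hne hball b hη hηc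
    (hηs.trans hsupp) hη0
  have hηi : Integrable η := hη.continuous.integrable_of_hasCompactSupport hηc
  have hI1 : Integrable (fun x => ∑ i, lineDeriv ℝ δ x (b i) * lineDeriv ℝ η x (b i)) :=
    integrable_finsetSum _ fun i _ => hδ.integrable_lineDeriv_mul hη hηc _ _
  have hI2 : Integrable (fun x => ∑ i, lineDeriv ℝ g x (b i) ^ 2) :=
    integrable_finsetSum _ fun i _ => by
      simpa only [sq] using hg.integrable_lineDeriv_mul hg hc (b i) (b i)
  have hcg := hg.continuous
  have hcδ := hδ.continuous
  have hI3 : Integrable (fun x => (1 / 4 * (1 / δ x ^ 2) - 3 / 4 * K ^ 2) * g x ^ 2) := by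
    have : Integrable (fun x => (1 / 4 * (1 / max (δ x) s ^ 2) - 3 / 4 * K ^ 2) * g x ^ 2) := by
      refine Continuous.integrable_of_hasCompactSupport ?_ ?_
      · have : ∀ x, max (δ x) s ^ 2 ≠ 0 := fun x =>
          (pow_pos (hs.trans_le (le_max_right _ _)) 2).ne'
        fun_prop (disch := assumption)
      · simp only [sq]
        exact (hc.mul_left (f := g)).mul_left
    refine this.congr (Eventually.of_forall fun x => ?_)
    by_cases hx : x ∈ tsupport g
    · simp only [max_eq_left (hlt x hx).le, hδdef]
    · simp [image_eq_zero_of_notMem_tsupport hx]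
  -- Expand |∇g - g h(δ)∇δ|² ≥ 0 with |∇δ| = 1 and apply the Riccati inequality. After integration
  -- Kη + ∇δ·∇η contributes a nonnegative amount, by `hweak`.
  have hpt : ∀ᵐ x, (1 / 4 * (1 / δ x ^ 2) - 3 / 4 * K ^ 2) * g x ^ 2 + K * η x
      + ∑ i, lineDeriv ℝ δ x (b i) * lineDeriv ℝ η x (b i)
      ≤ ∑ i, lineDeriv ℝ g x (b i) ^ 2 := by
    filter_upwards [hδ.ae_differentiableAt, hg.ae_differentiableAt] with x hxδ hxg
    by_cases hx : x ∈ tsupport g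
    · have hsx : s < δ x := hlt x hx
      have hδ0 : 0 < δ x := hs.trans hsx
      have hev : η =ᶠ[𝓝 x] fun y => g y * g y * h (δ y) := by
        filter_upwards [hcδ.continuousAt.eventually (lt_mem_nhds hsx)] with y hy
        simp only [hηdef, max_eq_left (le_of_lt hy)]
      have hdh : HasDerivAt h _ (δ x) := hasDerivAt_hardyWeight hK hδ0
      have hdη := (hxg.hasFDerivAt.mul hxg.hasFDerivAt).mul
        (hdh.comp_hasFDerivAt x hxδ.hasFDerivAt)
      have hηx : η x = g x * g x * h (δ x) := hev.self_of_nhds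
      have hld : ∀ i, lineDeriv ℝ η x (b i) = 2 * (g x * h (δ x)) * fderiv ℝ g x (b i) +
          g x ^ 2 * (-1 / (2 * δ x ^ 2) + K ^ 2 / (2 * (1 + K * δ x) ^ 2)) *
            fderiv ℝ δ x (b i) := by
        intro i
        rw [hev.lineDeriv_eq]
        refine ((hdη.hasLineDerivAt (b i)).lineDeriv).trans ?_
        simp only [Function.comp, add_apply, smul_apply,
          smul_eq_mul, Pi.mul_apply]
        ring
      have hg' : ∀ i, lineDeriv ℝ g x (b i) = fderiv ℝ g x (b i) := fun i =>
        hxg.lineDeriv_eq_fderiv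
      have hδ' : ∀ i, lineDeriv ℝ δ x (b i) = fderiv ℝ δ x (b i) := fun i =>
        hxδ.lineDeriv_eq_fderiv
      have hone : ∑ i, fderiv ℝ δ x (b i) ^ 2 = 1 := by
        rw [b.sum_apply_sq_eq_norm_sq,
          norm_fderiv_infDist_compl_eq_one hΩ hne (hsupp hx) hxδ, one_pow]
      simp only [hld, hg', hδ', hηx]
      have hsq : 0 ≤ ∑ i, (fderiv ℝ g x (b i) - g x * h (δ x) * fderiv ℝ δ x (b i)) ^ 2 :=
        Finset.sum_nonneg fun i _ => sq_nonneg _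
      have hexp : ∑ i, (fderiv ℝ g x (b i) - g x * h (δ x) * fderiv ℝ δ x (b i)) ^ 2 =
          ∑ i, fderiv ℝ g x (b i) ^ 2
            - 2 * (g x * h (δ x)) * ∑ i, fderiv ℝ δ x (b i) * fderiv ℝ g x (b i)
            + (g x * h (δ x)) ^ 2 * ∑ i, fderiv ℝ δ x (b i) ^ 2 := by
        rw [Finset.mul_sum, Finset.mul_sum, ← Finset.sum_sub_distrib, ← Finset.sum_add_distrib]
        exact Finset.sum_congr rfl fun i _ => by ring
      have hexp2 : ∑ i, fderiv ℝ δ x (b i) * (2 * (g x * h (δ x)) * fderiv ℝ g x (b i) +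
          g x ^ 2 * (-1 / (2 * δ x ^ 2) + K ^ 2 / (2 * (1 + K * δ x) ^ 2)) *
            fderiv ℝ δ x (b i)) =
          2 * (g x * h (δ x)) * ∑ i, fderiv ℝ δ x (b i) * fderiv ℝ g x (b i)
            + g x ^ 2 * (-1 / (2 * δ x ^ 2) + K ^ 2 / (2 * (1 + K * δ x) ^ 2)) *
              ∑ i, fderiv ℝ δ x (b i) ^ 2 := by
        rw [Finset.mul_sum, Finset.mul_sum, ← Finset.sum_add_distrib]
        exact Finset.sum_congr rfl fun i _ => by ring
      rw [hexp2, hone]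
      rw [hexp, hone] at hsq
      have hric := mul_le_mul_of_nonneg_left (hardyWeight_riccati hK hδ0) (sq_nonneg (g x))
      simp only [hh] at hsq ⊢
      linarith
    · have hgx : g x = 0 := image_eq_zero_of_notMem_tsupport hx
      have hηx : η x = 0 := image_eq_zero_of_notMem_tsupport fun hn => hx (hηs hn)
      simp [hηx, hgx, lineDeriv_eq_zero_of_notMem_tsupport hx,
        lineDeriv_eq_zero_of_notMem_tsupport fun hn => hx (hηs hn)]
  have hfin := integral_mono_ae ((hI3.add (hηi.const_mul K)).add hI1) hI2 hpt
  rw [integral_add' (hI3.add (hηi.const_mul K)) hI1, integral_add' hI3 (hηi.const_mul K),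
    integral_const_mul] at hfin
  linarith

/-- Integration by parts against a Lipschitz function. -/
theorem integral_sum_lineDeriv_mul_eq_neg_laplacian (b : OrthonormalBasis ι ℝ E) {u w : E → ℝ}
    (hu : ContDiff ℝ 2 u) (hc : HasCompactSupport u) {D : NNReal} (hw : LipschitzWith D w)
    (hwc : HasCompactSupport w) :
    ∫ x, ∑ i, lineDeriv ℝ u x (b i) * lineDeriv ℝ w x (b i) =
      -∫ x, w x * Laplacian.laplacian u x := by
  obtain ⟨C, hC⟩ := (hu.of_le one_le_two).lipschitzWith_of_hasCompactSupport hc (by simp)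
  have hterm : ∀ i, ∫ x, lineDeriv ℝ u x (b i) * lineDeriv ℝ w x (b i) =
      -∫ x, w x * lineDeriv ℝ (fun y => lineDeriv ℝ u y (b i)) x (b i) := by
    intro i
    obtain ⟨C', hC'⟩ := hu.exists_lipschitzWith_lineDeriv hc (b i)
    have := hC'.integral_lineDeriv_mul_eq (μ := volume) hw hwc (b i)
    simp only [lineDeriv_neg, neg_mul, integral_neg] at this
    simp only [mul_comm (w _), this, neg_neg]
    exact integral_congr_ae (Eventually.of_forall fun x => mul_comm _ _)
  simp only [laplacian_eq_sum_lineDeriv b hu, Finset.mul_sum]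
  rw [integral_finsetSum _ fun i _ => hC.integrable_lineDeriv_mul hw hwc _ _,
    integral_finsetSum, ← Finset.sum_neg_distrib]
  · exact Finset.sum_congr rfl fun i _ => hterm i
  · intro i _
    obtain ⟨C', hC'⟩ := hu.exists_lipschitzWith_lineDeriv hc (b i)
    have hcs : HasCompactSupport (fun y => lineDeriv ℝ u y (b i)) :=
      hc.mono' fun x hx => by
        by_contra hn
        exact hx (lineDeriv_eq_zero_of_notMem_tsupport hn _)
    obtain ⟨B, hB⟩ := hwc.exists_bound_of_continuous hw.continuous
    exact (hC'.integrable_lineDeriv hcs (b i)).bdd_mul hw.continuous.aestronglyMeasurable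
      (Eventually.of_forall hB)

/-- Localized energy inequality for a smooth function. -/
theorem localized_energy_inequality {Ω : Set E} {ρ : ℝ}
    (hρ : 0 < ρ) (hΩ : IsOpen Ω) (hne : Ω ≠ univ) (hball : HasExteriorBalls Ω ρ)
    (b : OrthonormalBasis ι ℝ E) {u : E → ℝ} (hu : ContDiff ℝ 2 u) (huc : HasCompactSupport u)
    {D : NNReal} {f : E → ℝ} (hf : LipschitzWith D f)
    (hc : HasCompactSupport f) (hsupp : tsupport f ⊆ Ω) :
    (∫ x, (1 / 4 * (1 / Metric.infDist x Ωᶜ ^ 2) - 3 / 4 * (Fintype.card ι / ρ) ^ 2) *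
        (f x * u x) ^ 2) + ∫ x, f x * f x * u x * Laplacian.laplacian u x ≤
      ∫ x, (∑ i, lineDeriv ℝ f x (b i) ^ 2) * u x ^ 2 := by
  obtain ⟨C, hC⟩ := (hu.of_le one_le_two).lipschitzWith_of_hasCompactSupport huc (by simp)
  have hub := hC.isBoundedLipschitz_of_hasCompactSupport huc
  have hfb := hf.isBoundedLipschitz_of_hasCompactSupport hc
  obtain ⟨⟨D₁, h1⟩, -⟩ := hfb.mul hub
  obtain ⟨⟨D₂, h2⟩, -⟩ := (hfb.mul hfb).mul hub
  have hc1 : HasCompactSupport (fun x => f x * u x) := hc.mul_right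
  have hc2 : HasCompactSupport (fun x => f x * f x * u x) := huc.mul_left
  have hs1 : tsupport (fun x => f x * u x) ⊆ Ω :=
    (tsupport_mul_subset_left).trans hsupp
  have hardy := hardy_inequality hρ hΩ hne hball b h1 hc1 hs1
  have hibp := integral_sum_lineDeriv_mul_eq_neg_laplacian b hu huc h2 hc2
  -- The identity |∇(fu)|² = ∇u·∇(f²u) + |∇f|²u²; the derivatives of u are confined to a term that
  -- integrates by parts.
  have hpt : (fun x => ∑ i, lineDeriv ℝ (fun x => f x * u x) x (b i) ^ 2) =ᵐ[volume]
      (fun x => ∑ i, lineDeriv ℝ u x (b i) * lineDeriv ℝ (fun x => f x * f x * u x) x (b i)) +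
        fun x => (∑ i, lineDeriv ℝ f x (b i) ^ 2) * u x ^ 2 := by
    filter_upwards [hf.ae_differentiableAt] with x hx
    have hxu := hu.differentiable two_ne_zero x
    have e1 : ∀ i, lineDeriv ℝ (fun x => f x * u x) x (b i) =
        f x * fderiv ℝ u x (b i) + u x * fderiv ℝ f x (b i) := by
      intro i
      refine ((hx.hasFDerivAt.mul hxu.hasFDerivAt).hasLineDerivAt (b i)).lineDeriv.trans ?_
      simp
    have e2 : ∀ i, lineDeriv ℝ (fun x => f x * f x * u x) x (b i) =
        f x * f x * fderiv ℝ u x (b i) + u x * (2 * f x * fderiv ℝ f x (b i)) := by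
      intro i
      refine (((hx.hasFDerivAt.mul hx.hasFDerivAt).mul hxu.hasFDerivAt).hasLineDerivAt
        (b i)).lineDeriv.trans ?_
      simp
      ring
    simp only [Pi.add_apply, e1, e2, hx.lineDeriv_eq_fderiv, hxu.lineDeriv_eq_fderiv]
    rw [Finset.sum_mul, ← Finset.sum_add_distrib]
    exact Finset.sum_congr rfl fun i _ => by ring
  have hi1 : Integrable (fun x => ∑ i, lineDeriv ℝ u x (b i) *
      lineDeriv ℝ (fun x => f x * f x * u x) x (b i)) :=
    integrable_finsetSum _ fun i _ => hC.integrable_lineDeriv_mul h2 hc2 _ _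
  have hi2 : Integrable (fun x => ∑ i, lineDeriv ℝ (fun x => f x * u x) x (b i) ^ 2) :=
    integrable_finsetSum _ fun i _ => by
      simpa only [sq] using h1.integrable_lineDeriv_mul h1 hc1 (b i) (b i)
  have hi3 : Integrable (fun x => (∑ i, lineDeriv ℝ f x (b i) ^ 2) * u x ^ 2) := by
    refine (hi2.sub hi1).congr ?_
    filter_upwards [hpt] with x hx
    rw [Pi.sub_apply, hx, Pi.add_apply, add_sub_cancel_left]
  rw [integral_congr_ae hpt, integral_add' hi1 hi3, hibp] at hardy
  linarith

end Hardy

/-! ### Bilinear integrals under mean square convergence. -/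

section SquareIntegrable

variable {α : Type*} [MeasurableSpace α] {μ : Measure α}

theorem MeasureTheory.MemLp.integrable_bdd_mul_mul {B u v : α → ℝ} {C : ℝ}
    (hB : AEStronglyMeasurable B μ) (hBC : ∀ x, |B x| ≤ C) (hu : MemLp u 2 μ) (hv : MemLp v 2 μ) :
    Integrable (fun x => B x * (u x * v x)) μ :=
  (hu.integrable_mul hv).bdd_mul hB (Eventually.of_forall hBC)

theorem integral_sub_sq_le_three {a b c d : α → ℝ} (hab : MemLp (a - b) 2 μ)
    (hbc : MemLp (b - c) 2 μ) (hcd : MemLp (c - d) 2 μ) :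
    ∫ x, (a x - d x) ^ 2 ∂μ ≤ 3 * (∫ x, (a x - b x) ^ 2 ∂μ + ∫ x, (b x - c x) ^ 2 ∂μ
      + ∫ x, (c x - d x) ^ 2 ∂μ) := by
  have h1 : Integrable (fun x => (a x - b x) ^ 2) μ := hab.integrable_sq
  have h2 : Integrable (fun x => (b x - c x) ^ 2) μ := hbc.integrable_sq
  have h3 : Integrable (fun x => (c x - d x) ^ 2) μ := hcd.integrable_sq
  have h4 : Integrable (fun x => (a x - d x) ^ 2) μ := by
    refine ((hab.add hbc).add hcd).integrable_sq.congr (Eventually.of_forall fun x => ?_)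
    simp
  have hle := integral_mono h4 (((h1.add h2).add h3).const_mul 3) fun x => by
    simp only [Pi.add_apply]
    nlinarith [sq_nonneg ((a x - b x) - (b x - c x)), sq_nonneg ((b x - c x) - (c x - d x)),
      sq_nonneg ((a x - b x) - (c x - d x))]
  rw [integral_const_mul, integral_add' (h1.add h2) h3, integral_add' h1 h2] at hle
  exact hle

/-- Bounded bilinear integrals pass to the limit under mean square convergence. -/
theorem tendsto_integral_bdd_mul_mul {B u v : α → ℝ} {U V : ℕ → α → ℝ} {C : ℝ}
    (hB : AEStronglyMeasurable B μ) (hBC : ∀ x, |B x| ≤ C)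
    (hu : MemLp u 2 μ) (hv : MemLp v 2 μ) (hU : ∀ k, MemLp (U k) 2 μ) (hV : ∀ k, MemLp (V k) 2 μ)
    (hUu : Tendsto (fun k => ∫ x, (U k x - u x) ^ 2 ∂μ) atTop (𝓝 0))
    (hVv : Tendsto (fun k => ∫ x, (V k x - v x) ^ 2 ∂μ) atTop (𝓝 0)) :
    Tendsto (fun k => ∫ x, B x * (U k x * V k x) ∂μ) atTop (𝓝 (∫ x, B x * (u x * v x) ∂μ)) := by
  -- Young's inequality with a free ε: the cross terms cost ε times fixed norms plus 1/ε times
  -- errors that tend to zero.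
  have hbound : ∀ ε > 0, ∀ k, |∫ x, B x * (U k x * V k x) ∂μ - ∫ x, B x * (u x * v x) ∂μ| ≤
      C * ((1 + 1 / ε) * (∫ x, (U k x - u x) ^ 2 ∂μ + ∫ x, (V k x - v x) ^ 2 ∂μ)
        + ε * (∫ x, u x ^ 2 ∂μ + ∫ x, v x ^ 2 ∂μ)) := by
    intro ε hε k
    have i1 : Integrable (fun x => (U k x - u x) ^ 2) μ := ((hU k).sub hu).integrable_sq
    have i2 : Integrable (fun x => (V k x - v x) ^ 2) μ := ((hV k).sub hv).integrable_sq
    have i3 := hu.integrable_sq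
    have i4 := hv.integrable_sq
    have j1 := MemLp.integrable_bdd_mul_mul hB hBC (hU k) (hV k)
    have j2 := MemLp.integrable_bdd_mul_mul hB hBC hu hv
    rw [← integral_sub j1 j2, ← Real.norm_eq_abs]
    have hint : Integrable (fun x => C * ((1 + 1 / ε) * ((U k x - u x) ^ 2 + (V k x - v x) ^ 2)
        + ε * (u x ^ 2 + v x ^ 2))) μ :=
      (((i1.add i2).const_mul _).add ((i3.add i4).const_mul _)).const_mul _
    refine (norm_integral_le_of_norm_le hint (Eventually.of_forall fun x => ?_)).trans_eq ?_
    · rw [← mul_sub, norm_mul]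
      refine mul_le_mul (hBC x) ?_ (norm_nonneg _) ((abs_nonneg _).trans (hBC x))
      set a := U k x - u x with ha
      set b := V k x - v x with hb
      have e : U k x * V k x - u x * v x = a * b + (u x * b + v x * a) := by rw [ha, hb]; ring
      have hab : |a * b| ≤ a ^ 2 + b ^ 2 := by
        rw [abs_le]; constructor <;> nlinarith [sq_nonneg (a + b), sq_nonneg (a - b)]
      have hy : ∀ p q : ℝ, |p * q| ≤ ε * p ^ 2 + 1 / ε * q ^ 2 := by
        intro p q
        have h1 : ε * p ^ 2 + 1 / ε * q ^ 2 = ((ε * p) ^ 2 + q ^ 2) / ε := by field_simp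
        rw [h1, le_div_iff₀ hε, ← abs_of_pos hε, ← abs_mul, abs_of_pos hε, abs_le]
        constructor <;>
          nlinarith [sq_nonneg (ε * p + q), sq_nonneg (ε * p - q), sq_nonneg (ε * p), sq_nonneg q]
      rw [Real.norm_eq_abs, e]
      have := abs_add_le (a * b) (u x * b + v x * a)
      have := abs_add_le (u x * b) (v x * a)
      have := hy (u x) b
      have := hy (v x) a
      nlinarith
    · have i5 : Integrable (fun x => (1 + 1 / ε) * ((U k x - u x) ^ 2 + (V k x - v x) ^ 2)) μ :=
        (i1.add i2).const_mul _
      have i6 : Integrable (fun x => ε * (u x ^ 2 + v x ^ 2)) μ := (i3.add i4).const_mul _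
      rw [integral_const_mul, integral_add i5 i6,
        integral_const_mul, integral_const_mul, integral_add i1 i2, integral_add i3 i4]
  rw [tendsto_iff_dist_tendsto_zero]
  simp only [Real.dist_eq]
  rw [Metric.tendsto_atTop]
  intro e he
  set M := |C| * (∫ x, u x ^ 2 ∂μ + ∫ x, v x ^ 2 ∂μ) with hM
  have hM0 : 0 ≤ M := by positivity
  -- Makes ε M < e / 2; the + 1 covers M = 0.
  set ε := e / (2 * (M + 1)) with hεd
  have hε : 0 < ε := by positivity
  have hlim : Tendsto (fun k => |C| * ((1 + 1 / ε) *
      (∫ x, (U k x - u x) ^ 2 ∂μ + ∫ x, (V k x - v x) ^ 2 ∂μ))) atTop (𝓝 0) := by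
    simpa using ((hUu.add hVv).const_mul (1 + 1 / ε)).const_mul |C|
  obtain ⟨N, hN⟩ := eventually_atTop.1 (hlim.eventually (gt_mem_nhds (half_pos he)))
  refine ⟨N, fun k hk => ?_⟩
  rw [Real.dist_eq, sub_zero, abs_abs]
  have h1 := hbound ε hε k
  have h2 := hN k hk
  have h3 : ε * M < e / 2 := by
    rw [hεd, div_mul_eq_mul_div, div_lt_div_iff₀ (by positivity) two_pos]
    nlinarith
  refine h1.trans_lt ?_
  have hle : ∀ t : ℝ, 0 ≤ t → C * t ≤ |C| * t := fun t ht =>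
    mul_le_mul_of_nonneg_right (le_abs_self C) ht
  have hnn : 0 ≤ (1 + 1 / ε) * (∫ x, (U k x - u x) ^ 2 ∂μ + ∫ x, (V k x - v x) ^ 2 ∂μ)
      + ε * (∫ x, u x ^ 2 ∂μ + ∫ x, v x ^ 2 ∂μ) := by positivity
  refine (hle _ hnn).trans_lt ?_
  rw [mul_add]
  have : |C| * (ε * (∫ x, u x ^ 2 ∂μ + ∫ x, v x ^ 2 ∂μ)) = ε * M := by rw [hM]; ring
  rw [this]
  linarith

end SquareIntegrable

/-! ### Mollification in L² and its Laplacian. -/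

section Mollification

open ContinuousLinearMap
open scoped Convolution

theorem lineDeriv_comp_const_sub {E : Type*} [NormedAddCommGroup E] [NormedSpace ℝ E]
    (η : E → ℝ) (x t v : E) :
    lineDeriv ℝ (fun y => η (x - y)) t v = -lineDeriv ℝ η (x - t) v := by
  rw [← lineDeriv_neg]
  simp only [lineDeriv]
  congr 1
  funext s
  congr 1
  simp only [smul_neg]
  abel

variable {E : Type*} [NormedAddCommGroup E] [InnerProductSpace ℝ E] [FiniteDimensional ℝ E]
  [MeasurableSpace E] [BorelSpace E]

/-- Convolution of `u` with the normalized bump function `φ`. -/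
noncomputable def mollify (φ : ContDiffBump (0 : E)) (u : E → ℝ) : E → ℝ :=
  u ⋆[lsmul ℝ ℝ, volume] φ.normed volume

theorem mollify_eq_convolution (φ : ContDiffBump (0 : E)) (u : E → ℝ) :
    mollify φ u = φ.normed volume ⋆[lsmul ℝ ℝ, volume] u := by
  funext x
  rw [mollify, convolution_eq_swap, convolution_def]
  simp only [lsmul_apply, smul_eq_mul, mul_comm]

theorem mollify_apply (φ : ContDiffBump (0 : E)) (u : E → ℝ) (x : E) :
    mollify φ u x = ∫ t, u t * φ.normed volume (x - t) := by
  simp only [mollify, convolution_def, lsmul_apply, smul_eq_mul]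

theorem integrable_mul_normed_sub (φ : ContDiffBump (0 : E)) {u : E → ℝ}
    (hu : LocallyIntegrable u) (x : E) :
    Integrable (fun t => u t * φ.normed volume (x - t)) := by
  simpa [ConvolutionExistsAt] using
    (φ.hasCompactSupport_normed (μ := volume)).convolutionExists_right (lsmul ℝ ℝ) hu
      φ.continuous_normed x

theorem contDiff_mollify (φ : ContDiffBump (0 : E)) {u : E → ℝ} (hu : LocallyIntegrable u)
    (n : ℕ∞) : ContDiff ℝ n (mollify φ u) :=
  (φ.hasCompactSupport_normed (μ := volume)).contDiff_convolution_right (lsmul ℝ ℝ) hu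
    φ.contDiff_normed

theorem hasCompactSupport_mollify (φ : ContDiffBump (0 : E)) {u : E → ℝ}
    (hc : HasCompactSupport u) : HasCompactSupport (mollify φ u) :=
  hc.convolution (lsmul ℝ ℝ) φ.hasCompactSupport_normed

theorem mollify_sub (φ : ContDiffBump (0 : E)) {u v : E → ℝ} (hu : LocallyIntegrable u)
    (hv : LocallyIntegrable v) : mollify φ (u - v) = mollify φ u - mollify φ v := by
  funext x
  rw [Pi.sub_apply, mollify_apply, mollify_apply, mollify_apply,
    ← integral_sub (integrable_mul_normed_sub φ hu x) (integrable_mul_normed_sub φ hv x)]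
  simp only [Pi.sub_apply, sub_mul]

/-- Jensen's inequality, as nonnegativity of the variance of u under the probability density φ(x -
·). It makes mollification an L² contraction. -/
theorem mollify_sq_le (φ : ContDiffBump (0 : E)) {u : E → ℝ} (hu : MemLp u 2) (x : E) :
    mollify φ u x ^ 2 ≤ mollify φ (fun y => u y ^ 2) x := by
  have hl : LocallyIntegrable u := hu.locallyIntegrable (by norm_num)
  have i1 := integrable_mul_normed_sub φ hl x
  have i2 := integrable_mul_normed_sub φ hu.integrable_sq.locallyIntegrable x
  have i0 : Integrable (fun t => φ.normed volume (x - t)) :=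
    (φ.integrable_normed (μ := volume)).comp_sub_left x
  have hone : ∫ t, φ.normed volume (x - t) = 1 := by
    rw [integral_sub_left_eq_self (fun t => φ.normed volume t) volume x, φ.integral_normed]
  set m := mollify φ u x with hm
  have hpos : 0 ≤ ∫ t, (u t - m) ^ 2 * φ.normed volume (x - t) :=
    integral_nonneg fun t => mul_nonneg (sq_nonneg _) (φ.nonneg_normed _)
  have hexp : ∀ t, (u t - m) ^ 2 * φ.normed volume (x - t) = u t ^ 2 * φ.normed volume (x - t)
      - 2 * m * (u t * φ.normed volume (x - t)) + m ^ 2 * φ.normed volume (x - t) := by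
    intro t; ring
  simp only [hexp] at hpos
  have i3 : Integrable (fun t => u t ^ 2 * φ.normed volume (x - t)
      - 2 * m * (u t * φ.normed volume (x - t))) := i2.sub (i1.const_mul _)
  rw [integral_add i3 (i0.const_mul _), integral_sub i2 (i1.const_mul _),
    integral_const_mul, integral_const_mul, hone, ← mollify_apply, ← mollify_apply, ← hm] at hpos
  linarith

theorem integrable_mollify (φ : ContDiffBump (0 : E)) {u : E → ℝ} (hu : Integrable u) :
    Integrable (mollify φ u) :=
  hu.integrable_convolution (lsmul ℝ ℝ) φ.integrable_normed

theorem integral_mollify (φ : ContDiffBump (0 : E)) {u : E → ℝ} (hu : Integrable u) :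
    ∫ x, mollify φ u x = ∫ x, u x := by
  rw [mollify, integral_convolution _ hu φ.integrable_normed, φ.integral_normed]
  simp

theorem memLp_mollify (φ : ContDiffBump (0 : E)) {u : E → ℝ} (hu : MemLp u 2) :
    MemLp (mollify φ u) 2 := by
  have hl : LocallyIntegrable u := hu.locallyIntegrable (by norm_num)
  have hm : AEStronglyMeasurable (mollify φ u) volume :=
    (contDiff_mollify φ hl 0).continuous.aestronglyMeasurable
  rw [memLp_two_iff_integrable_sq hm]
  refine (integrable_mollify φ hu.integrable_sq).mono' (hm.pow 2)
    (Eventually.of_forall fun x => ?_)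
  rw [Real.norm_of_nonneg (sq_nonneg _)]
  exact mollify_sq_le φ hu x

theorem integral_mollify_sq_le (φ : ContDiffBump (0 : E)) {u : E → ℝ} (hu : MemLp u 2) :
    ∫ x, mollify φ u x ^ 2 ≤ ∫ x, u x ^ 2 := by
  rw [← integral_mollify φ hu.integrable_sq]
  exact integral_mono (memLp_mollify φ hu).integrable_sq (integrable_mollify φ hu.integrable_sq)
    (mollify_sq_le φ hu)

/-- Pointwise convergence is dominated: mollification keeps the bound on c and, once the radius is
below 1, stays supported in the 1-thickening of the support of c. -/
theorem tendsto_integral_mollify_sub_sq_of_continuous {φ : ℕ → ContDiffBump (0 : E)}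
    (hφ : Tendsto (fun k => (φ k).rOut) atTop (𝓝 0)) {c : E → ℝ} (hc : Continuous c)
    (hcs : HasCompactSupport c) :
    Tendsto (fun k => ∫ x, (mollify (φ k) c x - c x) ^ 2) atTop (𝓝 0) := by
  obtain ⟨B, hB⟩ := hcs.exists_bound_of_continuous hc
  have hB0 : 0 ≤ B := (norm_nonneg _).trans (hB 0)
  have hl : LocallyIntegrable c := hc.locallyIntegrable
  let S := Metric.cthickening 1 (tsupport c)
  have hS : IsCompact S := IsCompact.cthickening hcs
  have hmb : ∀ k x, |mollify (φ k) c x| ≤ B := by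
    intro k x
    rw [mollify_apply, ← Real.norm_eq_abs]
    have i0 : Integrable (fun t => B * (φ k).normed volume (x - t)) :=
      (((φ k).integrable_normed (μ := volume)).comp_sub_left x).const_mul B
    refine (norm_integral_le_of_norm_le i0 (Eventually.of_forall fun t => ?_)).trans_eq ?_
    · rw [norm_mul, Real.norm_of_nonneg ((φ k).nonneg_normed _)]
      exact mul_le_mul_of_nonneg_right (hB t) ((φ k).nonneg_normed _)
    · rw [integral_const_mul,
        integral_sub_left_eq_self (fun t => (φ k).normed volume t) volume x,
        (φ k).integral_normed, mul_one]
  have := tendsto_integral_filter_of_dominated_convergence (μ := (volume : Measure E))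
    (F := fun k x => (mollify (φ k) c x - c x) ^ 2) (f := fun _ => 0) (l := atTop)
    (S.indicator fun _ => (2 * B) ^ 2) ?_ ?_ ?_ ?_
  · simpa using this
  · exact Eventually.of_forall fun k =>
      (((contDiff_mollify (φ k) hl 0).continuous.sub hc).pow 2).aestronglyMeasurable
  · filter_upwards [hφ.eventually (gt_mem_nhds one_pos)] with k hk
    refine Eventually.of_forall fun x => ?_
    by_cases hx : x ∈ S
    · rw [indicator_of_mem hx, norm_pow, Real.norm_eq_abs]
      have h1 := hmb k x
      have h2 := hB x
      rw [Real.norm_eq_abs] at h2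
      have h3 := abs_sub (mollify (φ k) c x) (c x)
      gcongr
      linarith
    · have hcx : c x = 0 := by
        by_contra h
        exact hx (Metric.self_subset_cthickening _ (subset_tsupport _ h))
      have hmx : mollify (φ k) c x = 0 := by
        rw [mollify_apply]
        rw [integral_eq_zero_of_ae]
        refine Eventually.of_forall fun t => ?_
        by_contra h
        obtain ⟨h1, h2⟩ := not_or.1 (fun h' => h (mul_eq_zero.2 h'))
        have h3 : x - t ∈ Metric.ball (0 : E) (φ k).rOut := by
          rw [← (φ k).support_normed_eq (μ := volume)]; exact h2
        refine hx (Metric.mem_cthickening_of_dist_le x t 1 _ (subset_tsupport _ h1) ?_)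
        rw [mem_ball_zero_iff] at h3
        rw [dist_eq_norm]
        exact (h3.trans hk).le
      simp [hcx, hmx, indicator_of_notMem hx]
  · rw [integrable_indicator_iff hS.measurableSet]
    exact continuousOn_const.integrableOn_compact hS
  · refine Eventually.of_forall fun x => ?_
    have h := ContDiffBump.convolution_tendsto_right_of_continuous (μ := (volume : Measure E))
      hφ hc x
    simp only [← mollify_eq_convolution] at h
    simpa using (h.sub_const (c x)).pow 2

/-- Mollifications converge in `L²`. -/
theorem tendsto_integral_mollify_sub_sq {φ : ℕ → ContDiffBump (0 : E)}
    (hφ : Tendsto (fun k => (φ k).rOut) atTop (𝓝 0)) {u : E → ℝ} (hu : MemLp u 2) :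
    Tendsto (fun k => ∫ x, (mollify (φ k) u x - u x) ^ 2) atTop (𝓝 0) := by
  rw [Metric.tendsto_atTop]
  intro ε hε
  -- Three errors of size ε/12, times the factor 3 of the three-term estimate, stay below ε.
  obtain ⟨c, hcs, hcu, hc, hcm⟩ := MemLp.exists_hasCompactSupport_integral_rpow_sub_le
    (p := 2) two_pos (by simpa using hu) (ε := ε / 12) (by positivity)
  have hcm : MemLp c 2 := by simpa using hcm
  have hcu' : ∫ x, (u x - c x) ^ 2 ≤ ε / 12 := by simpa using hcu
  have hul : LocallyIntegrable u := hu.locallyIntegrable (by norm_num)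
  obtain ⟨N, hN⟩ := eventually_atTop.1
    ((tendsto_integral_mollify_sub_sq_of_continuous hφ hc hcs).eventually
      (gt_mem_nhds (show (0 : ℝ) < ε / 12 by positivity)))
  refine ⟨N, fun k hk => ?_⟩
  rw [Real.dist_eq, sub_zero, abs_of_nonneg (integral_nonneg fun x => sq_nonneg _)]
  have h1 := integral_sub_sq_le_three (a := mollify (φ k) u) (b := mollify (φ k) c) (c := c) (d := u)
    ((memLp_mollify _ hu).sub (memLp_mollify _ hcm)) ((memLp_mollify _ hcm).sub hcm) (hcm.sub hu)
  have h2 : ∫ x, (mollify (φ k) u x - mollify (φ k) c x) ^ 2 ≤ ε / 12 := by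
    have := integral_mollify_sq_le (φ k) (hu.sub hcm)
    rw [mollify_sub _ hul hc.locallyIntegrable] at this
    exact this.trans hcu'
  have h3 := hN k hk
  have h4 : ∫ x, (c x - u x) ^ 2 = ∫ x, (u x - c x) ^ 2 := by
    congr 1; funext x; ring
  rw [h4] at h1
  linarith

theorem lineDeriv_convolution_right {u η : E → ℝ} (hu : LocallyIntegrable u)
    (hη : ContDiff ℝ 1 η) (hc : HasCompactSupport η) (x v : E) :
    lineDeriv ℝ (u ⋆[lsmul ℝ ℝ, volume] η) x v =
      (u ⋆[lsmul ℝ ℝ, volume] fun y => lineDeriv ℝ η y v) x := by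
  have h := hc.hasFDerivAt_convolution_right (lsmul ℝ ℝ) hu hη x
  rw [(h.hasLineDerivAt v).lineDeriv,
    convolution_precompR_apply _ hu (hc.fderiv ℝ) (hη.continuous_fderiv one_ne_zero)]
  congr 1
  funext y
  exact ((hη.differentiable one_ne_zero y).lineDeriv_eq_fderiv).symm

theorem laplacian_comp_const_sub {E : Type*} [NormedAddCommGroup E] [InnerProductSpace ℝ E]
    [FiniteDimensional ℝ E] {η : E → ℝ} (hη : ContDiff ℝ 2 η) (x t : E) :
    Laplacian.laplacian (fun y => η (x - y)) t = Laplacian.laplacian η (x - t) := by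
  have hθ : ContDiff ℝ 2 (fun y => η (x - y)) := hη.comp (contDiff_const.sub contDiff_id)
  rw [laplacian_eq_sum_lineDeriv (stdOrthonormalBasis ℝ E) hθ,
    laplacian_eq_sum_lineDeriv (stdOrthonormalBasis ℝ E) hη]
  refine Finset.sum_congr rfl fun i _ => ?_
  simp only [lineDeriv_comp_const_sub]
  have h := lineDeriv_comp_const_sub
    (fun y => lineDeriv ℝ η y (stdOrthonormalBasis ℝ E i)) x t (stdOrthonormalBasis ℝ E i)
  have h' : ∀ f : E → ℝ, ∀ v, lineDeriv ℝ (fun y => -f y) t v = -lineDeriv ℝ f t v := by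
    intro f v
    simp only [lineDeriv]
    exact deriv.fun_neg
  rw [h', h, neg_neg]

/-- Both derivatives fall on the bump, and the two signs from the reflection cancel. The outcome
pairs u with the Laplacian of a test function, as a distributional equation requires. -/
theorem laplacian_mollify (φ : ContDiffBump (0 : E)) {u : E → ℝ} (hu : LocallyIntegrable u)
    (x : E) : Laplacian.laplacian (mollify φ u) x =
      ∫ t, u t * Laplacian.laplacian (fun y => φ.normed volume (x - y)) t := by
  set b := stdOrthonormalBasis ℝ E
  set η := φ.normed volume with hηd
  have hη : ContDiff ℝ 2 η := φ.contDiff_normed (n := 2)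
  have hc : HasCompactSupport η := φ.hasCompactSupport_normed
  have hc' : ∀ i, HasCompactSupport (fun y => lineDeriv ℝ η y (b i)) := fun i =>
    hc.mono' fun x hx => by
      by_contra hn
      exact hx (lineDeriv_eq_zero_of_notMem_tsupport hn _)
  have hη' : ∀ i, ContDiff ℝ 1 (fun y => lineDeriv ℝ η y (b i)) := fun i => by
    have h1 : (fun y => lineDeriv ℝ η y (b i)) = fun y => fderiv ℝ η y (b i) := by
      funext y
      exact (hη.differentiable two_ne_zero y).lineDeriv_eq_fderiv
    rw [h1]
    exact (hη.fderiv_right (m := 1) (by norm_num)).clm_apply contDiff_const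
  have hm : ContDiff ℝ 2 (mollify φ u) := contDiff_mollify φ hu 2
  rw [laplacian_eq_sum_lineDeriv b hm]
  have h1 : ∀ i, (fun y => lineDeriv ℝ (mollify φ u) y (b i)) =
      u ⋆[lsmul ℝ ℝ, volume] fun y => lineDeriv ℝ η y (b i) := fun i => by
    funext y
    exact lineDeriv_convolution_right hu (hη.of_le one_le_two) hc y (b i)
  simp only [h1, lineDeriv_convolution_right hu (hη' _) (hc' _), convolution_def, lsmul_apply,
    smul_eq_mul]
  rw [← integral_finsetSum]
  · congr 1
    funext t
    rw [laplacian_comp_const_sub hη, laplacian_eq_sum_lineDeriv b hη, Finset.mul_sum]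
  · intro i _
    have hc2 : HasCompactSupport (fun y => lineDeriv ℝ (fun z => lineDeriv ℝ η z (b i)) y (b i)) :=
      (hc' i).mono' fun x hx => by
        by_contra hn
        exact hx (lineDeriv_eq_zero_of_notMem_tsupport hn _)
    have hcont : Continuous (fun y => lineDeriv ℝ (fun z => lineDeriv ℝ η z (b i)) y (b i)) := by
      have h1 : (fun y => lineDeriv ℝ (fun z => lineDeriv ℝ η z (b i)) y (b i)) =
          fun y => fderiv ℝ (fun z => lineDeriv ℝ η z (b i)) y (b i) := by
        funext y
        exact ((hη' i).differentiable one_ne_zero y).lineDeriv_eq_fderiv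
      rw [h1]
      exact ((hη' i).continuous_fderiv one_ne_zero).clm_apply continuous_const
    simpa [ConvolutionExistsAt] using hc2.convolutionExists_right (lsmul ℝ ℝ) hu hcont x

end Mollification

/-! ### Distributional solutions and their localized energy inequality. -/

section WeakSolutions

variable {ι E : Type*} [Fintype ι] [NormedAddCommGroup E] [InnerProductSpace ℝ E]
  [FiniteDimensional ℝ E] [MeasurableSpace E] [BorelSpace E]

/-- `u` solves `Δu = W u` in the sense of distributions on `Ω`. -/
def IsWeakSolution (Ω : Set E) (W u : E → ℝ) : Prop :=
  ∀ θ : E → ℝ, ContDiff ℝ (⊤ : ℕ∞) θ → HasCompactSupport θ → tsupport θ ⊆ Ω →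
    ∫ x, u x * Laplacian.laplacian θ x = ∫ x, u x * (W x * θ x)

theorem MeasureTheory.MemLp.indicator_mul_of_memLp_top {S : Set E} (hS : MeasurableSet S)
    {u W : E → ℝ} (hu : MemLp u 2) (hW : MemLp W ∞ (volume.restrict S)) :
    MemLp (S.indicator fun x => u x * W x) 2 := by
  rw [memLp_indicator_iff_restrict hS]
  exact (hW.mul (hu.restrict S) (r := 2)).congr_norm
    ((hu.restrict S).aestronglyMeasurable.mul hW.aestronglyMeasurable)
    (Eventually.of_forall fun x => by simp)

/-- The Laplacian of a mollified weak solution is the mollification of `W u`. -/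
theorem IsWeakSolution.laplacian_mollify {Ω S : Set E} {W u : E → ℝ} (h : IsWeakSolution Ω W u)
    (hu : LocallyIntegrable u) (hSΩ : S ⊆ Ω) (φ : ContDiffBump (0 : E)) {x : E}
    (hx : Metric.closedBall x φ.rOut ⊆ S) :
    Laplacian.laplacian (mollify φ u) x = mollify φ (S.indicator fun y => u y * W y) x := by
  set θ : E → ℝ := fun y => φ.normed volume (x - y) with hθ
  -- The reflected bump lives in the closed ball, hence in S, so the truncation to S is invisible to
  -- it.
  have hts : tsupport θ ⊆ Metric.closedBall x φ.rOut := by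
    refine closure_minimal (fun y hy => ?_) Metric.isClosed_closedBall
    have : x - y ∈ Metric.ball (0 : E) φ.rOut := by
      rw [← φ.support_normed_eq (μ := volume)]; exact hy
    rw [mem_ball_zero_iff] at this
    rw [Metric.mem_closedBall, dist_comm, dist_eq_norm]
    exact this.le
  have hθs : ContDiff ℝ (⊤ : ℕ∞) θ :=
    (φ.contDiff_normed (n := ⊤)).comp (contDiff_const.sub contDiff_id)
  have hθc : HasCompactSupport θ :=
    (isCompact_closedBall x φ.rOut).of_isClosed_subset (isClosed_tsupport _) hts
  rw [_root_.laplacian_mollify φ hu, h θ hθs hθc (hts.trans (hx.trans hSΩ)), mollify_apply]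
  congr 1
  funext y
  by_cases hy : y ∈ S
  · rw [indicator_of_mem hy, mul_assoc]
  · have : θ y = 0 := image_eq_zero_of_notMem_tsupport fun hn => hy (hx (hts hn))
    rw [indicator_of_notMem hy, this]
    simp

/-- Localized energy inequality for a square integrable weak solution. -/
theorem IsWeakSolution.localized_energy_inequality {Ω : Set E} {ρ : ℝ}
    (hρ : 0 < ρ) (hΩ : IsOpen Ω) (hne : Ω ≠ univ) (hball : HasExteriorBalls Ω ρ)
    (b : OrthonormalBasis ι ℝ E) {W u : E → ℝ} (h : IsWeakSolution Ω W u) (hu : MemLp u 2)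
    (huc : HasCompactSupport u)
    (hW : ∀ S : Set E, IsCompact S → S ⊆ Ω → MemLp W ∞ (volume.restrict S))
    {D : NNReal} {f : E → ℝ} (hf : LipschitzWith D f)
    (hc : HasCompactSupport f) (hsupp : tsupport f ⊆ Ω) :
    Integrable (fun x => (1 / 4 * (1 / Metric.infDist x Ωᶜ ^ 2)
        - 3 / 4 * (Fintype.card ι / ρ) ^ 2 + W x) * (f x * u x) ^ 2) ∧
      Integrable (fun x => (∑ i, lineDeriv ℝ f x (b i) ^ 2) * u x ^ 2) ∧
      ∫ x, (1 / 4 * (1 / Metric.infDist x Ωᶜ ^ 2) - 3 / 4 * (Fintype.card ι / ρ) ^ 2 + W x) *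
        (f x * u x) ^ 2 ≤ ∫ x, (∑ i, lineDeriv ℝ f x (b i) ^ 2) * u x ^ 2 := by
  set K : ℝ := Fintype.card ι / ρ with hK
  have hul : LocallyIntegrable u := hu.locallyIntegrable (by norm_num)
  -- Mollifiers of radius below r, centred on the support of f, only see values on the compact set
  -- S, where W is essentially bounded.
  obtain ⟨r, hr, hrΩ⟩ := hc.exists_cthickening_subset_open hΩ hsupp
  set S := Metric.cthickening r (tsupport f) with hS
  have hSc : IsCompact S := IsCompact.cthickening hc
  set w : E → ℝ := S.indicator fun x => u x * W x with hw
  have hwL : MemLp w 2 := hu.indicator_mul_of_memLp_top hSc.measurableSet (hW S hSc hrΩ)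
  obtain ⟨s, hs, hlt⟩ := exists_pos_lt_infDist_compl hΩ hne hc hsupp
  have hcf := hf.continuous
  have hcδ : Continuous fun x => Metric.infDist x Ωᶜ := Metric.continuous_infDist_pt Ωᶜ
  -- Replacing δ by max δ s makes A continuous and bounded; f vanishes wherever the two differ.
  set A : E → ℝ := fun x =>
    (1 / 4 * (1 / max (Metric.infDist x Ωᶜ) s ^ 2) - 3 / 4 * K ^ 2) * (f x * f x) with hA
  have hAeq : ∀ x t, A x * (t * t) =
      (1 / 4 * (1 / Metric.infDist x Ωᶜ ^ 2) - 3 / 4 * K ^ 2) * (f x * t) ^ 2 := by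
    intro x t
    by_cases hx : x ∈ tsupport f
    · simp only [hA, max_eq_left (hlt x hx).le]; ring
    · simp [hA, image_eq_zero_of_notMem_tsupport hx]
  have hAc : Continuous A := by
    have : ∀ x, max (Metric.infDist x Ωᶜ) s ^ 2 ≠ 0 := fun x =>
      (pow_pos (hs.trans_le (le_max_right _ _)) 2).ne'
    fun_prop (disch := assumption)
  obtain ⟨CA, hCA⟩ := (show HasCompactSupport A from (hc.mul_left (f := f)).mul_left
    ).exists_bound_of_continuous hAc
  obtain ⟨Cf, hCf⟩ := (show HasCompactSupport (fun x => f x * f x) from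
    hc.mul_left).exists_bound_of_continuous (hcf.mul hcf)
  have hGm : AEStronglyMeasurable (fun x => ∑ i, lineDeriv ℝ f x (b i) ^ 2) (volume : Measure E) :=
    Finset.aestronglyMeasurable_fun_sum _ fun i _ =>
      (aestronglyMeasurable_lineDeriv hcf volume).pow 2
  have hGb : ∀ x, |∑ i, lineDeriv ℝ f x (b i) ^ 2| ≤ ∑ _i : ι, (D : ℝ) ^ 2 := by
    intro x
    rw [abs_of_nonneg (Finset.sum_nonneg fun i _ => sq_nonneg _)]
    refine Finset.sum_le_sum fun i _ => ?_
    have := norm_lineDeriv_le_of_lipschitz ℝ hf (x₀ := x) (v := b i)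
    rw [b.norm_eq_one, mul_one, Real.norm_eq_abs] at this
    rw [← sq_abs]
    gcongr
  have hff : AEStronglyMeasurable (fun x => f x * f x) (volume : Measure E) :=
    (hcf.mul hcf).aestronglyMeasurable
  let φ : ℕ → ContDiffBump (0 : E) := fun k =>
    ⟨1 / (2 * ((k : ℝ) + 1)), 1 / ((k : ℝ) + 1), by positivity,
      one_div_lt_one_div_of_lt (by positivity) (by linarith [(Nat.cast_nonneg k : (0 : ℝ) ≤ k)])⟩
  have hφ : Tendsto (fun k => (φ k).rOut) atTop (𝓝 0) := tendsto_one_div_add_atTop_nhds_zero_nat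
  have hUm := fun k => memLp_mollify (φ k) hu
  have hVm := fun k => memLp_mollify (φ k) hwL
  have hUt := tendsto_integral_mollify_sub_sq hφ hu
  have hVt := tendsto_integral_mollify_sub_sq hφ hwL
  have l1 := tendsto_integral_bdd_mul_mul hAc.aestronglyMeasurable hCA hu hu hUm hUm hUt hUt
  have l2 := tendsto_integral_bdd_mul_mul hff hCf hu hwL hUm hVm
    hUt hVt
  have l3 := tendsto_integral_bdd_mul_mul hGm hGb hu hu hUm hUm hUt hUt
  -- The smooth inequality for the mollifications, whose Laplacian on the support of f is the
  -- mollified W u. Without derivatives of u left, L² convergence suffices for the limit.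
  have hev : ∀ᶠ k in atTop,
      (∫ x, A x * (mollify (φ k) u x * mollify (φ k) u x)) +
        ∫ x, f x * f x * (mollify (φ k) u x * mollify (φ k) w x) ≤
      ∫ x, (∑ i, lineDeriv ℝ f x (b i) ^ 2) * (mollify (φ k) u x * mollify (φ k) u x) := by
    filter_upwards [hφ.eventually (gt_mem_nhds hr)] with k hk
    have hen := _root_.localized_energy_inequality hρ hΩ hne hball b (contDiff_mollify (φ k) hul 2)
      (hasCompactSupport_mollify (φ k) huc) hf hc hsupp
    have e1 : ∀ x, f x * f x * mollify (φ k) u x * Laplacian.laplacian (mollify (φ k) u) x =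
        f x * f x * (mollify (φ k) u x * mollify (φ k) w x) := by
      intro x
      by_cases hx : x ∈ tsupport f
      · rw [h.laplacian_mollify hul hrΩ (φ k) (x := x), mul_assoc]
        intro y hy
        exact Metric.mem_cthickening_of_dist_le y x r _ hx (le_trans hy hk.le)
      · simp [image_eq_zero_of_notMem_tsupport hx]
    simp only [e1] at hen
    simp only [hAeq]
    simp only [← sq (mollify (φ k) u _)]
    exact hen
  have hfin := le_of_tendsto_of_tendsto (l1.add l2) l3 hev
  have i1 := MemLp.integrable_bdd_mul_mul hAc.aestronglyMeasurable hCA hu hu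
  have i2 := MemLp.integrable_bdd_mul_mul hff hCf hu hwL
  have i3 := MemLp.integrable_bdd_mul_mul hGm hGb hu hu
  have e2 : ∀ x, A x * (u x * u x) + f x * f x * (u x * w x) =
      (1 / 4 * (1 / Metric.infDist x Ωᶜ ^ 2) - 3 / 4 * K ^ 2 + W x) * (f x * u x) ^ 2 := by
    intro x
    rw [hAeq]
    by_cases hx : x ∈ tsupport f
    · have hxS : x ∈ S := Metric.self_subset_cthickening _ hx
      rw [hw, indicator_of_mem hxS]
      ring
    · simp [image_eq_zero_of_notMem_tsupport hx]
  refine ⟨?_, ?_, ?_⟩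
  · simpa only [Pi.add_def, e2] using i1.add i2
  · simpa only [← sq (u _)] using i3
  · rw [← integral_add i1 i2] at hfin
    simp only [e2] at hfin
    simpa only [← sq (u _)] using hfin

end WeakSolutions

/-! ### The exponential weight with a cutoff near the boundary. -/

section AgmonWeight

theorem deriv_smoothTransition_of_nonpos {y : ℝ} (hy : y ≤ 0) :
    deriv Real.smoothTransition y = 0 := by
  refine IsLocalMin.deriv_eq_zero (Eventually.of_forall fun z => ?_)
  rw [Real.smoothTransition.zero_of_nonpos hy]
  exact Real.smoothTransition.nonneg z

theorem deriv_smoothTransition_of_one_le {y : ℝ} (hy : 1 ≤ y) :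
    deriv Real.smoothTransition y = 0 := by
  refine IsLocalMax.deriv_eq_zero (Eventually.of_forall fun z => ?_)
  rw [Real.smoothTransition.one_of_one_le hy]
  exact Real.smoothTransition.le_one z

theorem exists_abs_deriv_smoothTransition_le :
    ∃ c > 0, ∀ y, |deriv Real.smoothTransition y| ≤ c := by
  have hc : Continuous (deriv Real.smoothTransition) :=
    (Real.smoothTransition.contDiff (n := 1)).continuous_deriv le_rfl
  have hs : HasCompactSupport (deriv Real.smoothTransition) := by
    refine HasCompactSupport.of_support_subset_isCompact (isCompact_Icc (a := (0 : ℝ)) (b := 1)) ?_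
    intro y hy
    constructor
    · by_contra! h
      exact hy (deriv_smoothTransition_of_nonpos h.le)
    · by_contra! h
      exact hy (deriv_smoothTransition_of_one_le h.le)
  obtain ⟨c, hcb⟩ := hs.exists_bound_of_continuous hc
  exact ⟨|c| + 1, by positivity, fun y => (hcb y).trans (by linarith [le_abs_self c])⟩

/-- The weight `exp (G t)`, cut off smoothly on `[s / 2, s]`. -/
noncomputable def agmonWeight (G : ℝ → ℝ) (s t : ℝ) : ℝ :=
  Real.exp (G t) * Real.smoothTransition (2 / s * t - 1)

/-- The derivative of `agmonWeight`. -/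
noncomputable def agmonWeightDeriv (G : ℝ → ℝ) (s t : ℝ) : ℝ :=
  Real.exp (G t) * (deriv G t * Real.smoothTransition (2 / s * t - 1) +
    2 / s * deriv Real.smoothTransition (2 / s * t - 1))

variable {G : ℝ → ℝ} {s : ℝ}

theorem two_div_mul_sub_one_nonpos (hs : 0 < s) {t : ℝ} (ht : t ≤ s / 2) :
    2 / s * t - 1 ≤ 0 := by
  rw [div_mul_eq_mul_div, sub_nonpos, div_le_one hs]; linarith

theorem one_le_two_div_mul_sub_one (hs : 0 < s) {t : ℝ} (ht : s ≤ t) : 1 ≤ 2 / s * t - 1 := by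
  rw [div_mul_eq_mul_div, le_sub_iff_add_le, le_div_iff₀ hs]; linarith

theorem agmonWeight_eq_zero (hs : 0 < s) {t : ℝ} (ht : t ≤ s / 2) : agmonWeight G s t = 0 := by
  rw [agmonWeight, Real.smoothTransition.zero_of_nonpos (two_div_mul_sub_one_nonpos hs ht),
    mul_zero]

theorem agmonWeight_eq_exp (hs : 0 < s) {t : ℝ} (ht : s ≤ t) :
    agmonWeight G s t = Real.exp (G t) := by
  rw [agmonWeight, Real.smoothTransition.one_of_one_le (one_le_two_div_mul_sub_one hs ht), mul_one]

theorem agmonWeightDeriv_eq_zero (hs : 0 < s) {t : ℝ} (ht : t ≤ s / 2) :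
    agmonWeightDeriv G s t = 0 := by
  have h := two_div_mul_sub_one_nonpos hs ht
  rw [agmonWeightDeriv, Real.smoothTransition.zero_of_nonpos h, deriv_smoothTransition_of_nonpos h]
  simp

/-- Below s/2 the weight is identically zero, so nothing is required of G at nonpositive arguments.
-/
theorem hasDerivAt_agmonWeight (hs : 0 < s) (hG : ∀ t, 0 < t → DifferentiableAt ℝ G t) (t : ℝ) :
    HasDerivAt (agmonWeight G s) (agmonWeightDeriv G s t) t := by
  rcases lt_or_ge t (s / 2) with ht | ht
  · rw [agmonWeightDeriv_eq_zero hs ht.le]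
    refine (hasDerivAt_const t (0 : ℝ)).congr_of_eventuallyEq ?_
    filter_upwards [gt_mem_nhds ht] with y hy using agmonWeight_eq_zero hs (le_of_lt hy)
  · have hg := (hG t (by linarith)).hasDerivAt.exp
    have hl : HasDerivAt (fun t => 2 / s * t - 1) (2 / s) t := by
      simpa using ((hasDerivAt_id t).const_mul (2 / s)).sub_const 1
    have hx : HasDerivAt Real.smoothTransition _ (2 / s * t - 1) :=
      ((Real.smoothTransition.contDiff (n := 1)).differentiable one_ne_zero _).hasDerivAt
    refine (hg.mul (hx.comp t hl)).congr_deriv ?_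
    simp only [agmonWeightDeriv, Function.comp]
    ring

/-- Away from the shell `[s / 2, s)`, the weight satisfies the eikonal equation of `G`. -/
theorem agmonWeightDeriv_sq_le (hs : 0 < s) {c : ℝ}
    (hc : ∀ y, |deriv Real.smoothTransition y| ≤ c)
    (hG' : ∀ t, 0 < t → 0 ≤ deriv G t ∧ deriv G t ≤ 1 / t) (hmono : MonotoneOn G (Ioi 0)) (t : ℝ) :
    agmonWeightDeriv G s t ^ 2 ≤ deriv G t ^ 2 * agmonWeight G s t ^ 2 +
      (Ico (s / 2) s).indicator (fun _ => Real.exp (2 * G s) * ((8 * c + 4 * c ^ 2) / s ^ 2)) t := by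
  rcases lt_or_ge t (s / 2) with ht | ht
  · rw [agmonWeightDeriv_eq_zero hs ht.le, agmonWeight_eq_zero hs ht.le,
      indicator_of_notMem fun h => absurd h.1 (not_le.2 ht)]
    simp
  rcases lt_or_ge t s with hts | hts
  · rw [indicator_of_mem (show t ∈ Ico (s / 2) s from ⟨ht, hts⟩)]
    have ht0 : 0 < t := by linarith
    rw [agmonWeightDeriv, agmonWeight]
    set y := 2 / s * t - 1
    set x := Real.smoothTransition y
    set d := deriv Real.smoothTransition y
    set g := deriv G t
    have hx0 : 0 ≤ x := Real.smoothTransition.nonneg y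
    have hx1 : x ≤ 1 := Real.smoothTransition.le_one y
    have hd : |d| ≤ c := hc y
    have hc0 : 0 ≤ c := (abs_nonneg _).trans hd
    have hg0 : 0 ≤ g := (hG' t ht0).1
    -- On the shell 1/t ≤ 2/s. This use of G' ≤ 1/t keeps the cross term at the order s⁻² of the
    -- squared cutoff derivative.
    have hg1 : g ≤ 2 / s := (hG' t ht0).2.trans (by
      rw [div_le_div_iff₀ ht0 hs]; linarith)
    have he : Real.exp (G t) ^ 2 ≤ Real.exp (2 * G s) := by
      rw [← Real.exp_nat_mul, Real.exp_le_exp]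
      have := hmono (show t ∈ Ioi (0 : ℝ) from ht0) (show s ∈ Ioi (0 : ℝ) from hs) hts.le
      push_cast
      linarith
    have hgx : g * x ≤ 2 / s := by nlinarith
    have hgx0 : 0 ≤ g * x := mul_nonneg hg0 hx0
    -- The cross term is at most 8c/s² and the square at most 4c²/s².
    have herr : 2 * (g * x) * (2 / s * d) + (2 / s * d) ^ 2 ≤ (8 * c + 4 * c ^ 2) / s ^ 2 := by
      have e : (8 * c + 4 * c ^ 2) / s ^ 2 = 2 * (2 / s) * (2 / s * c) + (2 / s * c) ^ 2 := by
        field_simp; ring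
      rw [e]
      have h2 : 0 ≤ 2 / s := by positivity
      have hd' : 2 / s * d ≤ 2 / s * c :=
        mul_le_mul_of_nonneg_left ((le_abs_self d).trans hd) h2
      have h3 : (2 / s * d) ^ 2 ≤ (2 / s * c) ^ 2 := by
        rw [← sq_abs, abs_mul, abs_of_nonneg h2]
        gcongr
      have h4 : 2 * (g * x) * (2 / s * d) ≤ 2 * (g * x) * (2 / s * c) :=
        mul_le_mul_of_nonneg_left hd' (by positivity)
      have h5 : 2 * (g * x) * (2 / s * c) ≤ 2 * (2 / s) * (2 / s * c) :=
        mul_le_mul_of_nonneg_right (by linarith) (by positivity)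
      linarith
    have hnn : 0 ≤ (8 * c + 4 * c ^ 2) / s ^ 2 := by positivity
    calc (Real.exp (G t) * (g * x + 2 / s * d)) ^ 2
        = g ^ 2 * (Real.exp (G t) * x) ^ 2 +
          Real.exp (G t) ^ 2 * (2 * (g * x) * (2 / s * d) + (2 / s * d) ^ 2) := by ring
      _ ≤ g ^ 2 * (Real.exp (G t) * x) ^ 2 +
          Real.exp (G t) ^ 2 * ((8 * c + 4 * c ^ 2) / s ^ 2) := by gcongr
      _ ≤ _ := by gcongr
  · have h := one_le_two_div_mul_sub_one hs hts
    rw [agmonWeight, agmonWeightDeriv, indicator_of_notMem fun h => absurd h.2 (not_lt.2 hts),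
      Real.smoothTransition.one_of_one_le h, deriv_smoothTransition_of_one_le h]
    apply le_of_eq
    ring

/-- The cutoff restricts the derivative to t > s/2, where G' ≤ 2/s and exp G ≤ exp B. -/
theorem exists_lipschitzWith_agmonWeight (hs : 0 < s) {B : ℝ}
    (hG : ∀ t, 0 < t → DifferentiableAt ℝ G t)
    (hG' : ∀ t, 0 < t → 0 ≤ deriv G t ∧ deriv G t ≤ 1 / t) (hB : ∀ t, 0 < t → G t ≤ B) :
    ∃ C, LipschitzWith C (agmonWeight G s) := by
  obtain ⟨c, hc0, hc⟩ := exists_abs_deriv_smoothTransition_le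
  have hb : ∀ t, |agmonWeightDeriv G s t| ≤ Real.exp B * (2 / s + 2 / s * c) := by
    intro t
    rcases le_or_gt t (s / 2) with ht | ht
    · rw [agmonWeightDeriv_eq_zero hs ht, abs_zero]
      positivity
    · have ht0 : 0 < t := by linarith
      rw [agmonWeightDeriv, abs_mul, abs_of_pos (Real.exp_pos _)]
      refine mul_le_mul (Real.exp_le_exp.2 (hB t ht0)) ?_ (abs_nonneg _) (Real.exp_pos _).le
      refine (abs_add_le _ _).trans (add_le_add ?_ ?_)
      · rw [abs_mul, abs_of_nonneg (hG' t ht0).1, abs_of_nonneg (Real.smoothTransition.nonneg _)]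
        have h1 : deriv G t ≤ 2 / s := (hG' t ht0).2.trans (by
          rw [div_le_div_iff₀ ht0 hs]; linarith)
        exact (mul_le_of_le_one_right (hG' t ht0).1 (Real.smoothTransition.le_one _)).trans h1
      · rw [abs_mul, abs_of_pos (show 0 < 2 / s by positivity)]
        gcongr
        exact hc _
  refine ⟨Real.toNNReal (Real.exp B * (2 / s + 2 / s * c)),
    lipschitzWith_of_nnnorm_deriv_le
      (fun t => (hasDerivAt_agmonWeight hs hG t).differentiableAt) fun t => ?_⟩
  rw [(hasDerivAt_agmonWeight hs hG t).deriv, ← NNReal.coe_le_coe, coe_nnnorm,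
    Real.coe_toNNReal _ (by positivity)]
  exact hb t

end AgmonWeight

/-! ### Agmon estimate: interior mass against shell mass. -/

section Decay

theorem isCompact_le_infDist_compl {E : Type*} [PseudoMetricSpace E] [ProperSpace E]
    {Ω : Set E} (hbdd : Bornology.IsBounded Ω) {s : ℝ}
    (hs : 0 < s) : IsCompact {x | s ≤ Metric.infDist x Ωᶜ} ∧ {x | s ≤ Metric.infDist x Ωᶜ} ⊆ Ω := by
  have hsub : {x | s ≤ Metric.infDist x Ωᶜ} ⊆ Ω := by
    intro x hx
    by_contra hn
    have : Metric.infDist x Ωᶜ = 0 := Metric.infDist_zero_of_mem hn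
    exact absurd (this ▸ hx : s ≤ 0) (not_le.2 hs)
  exact ⟨Metric.isCompact_of_isClosed_isBounded
    (isClosed_le continuous_const (Metric.continuous_infDist_pt _)) (hbdd.subset hsub), hsub⟩

variable {ι E : Type*} [Fintype ι] [NormedAddCommGroup E] [InnerProductSpace ℝ E]
  [FiniteDimensional ℝ E] [MeasurableSpace E] [BorelSpace E]

/-- Agmon-type estimate: the mass of a weak solution in the interior is controlled by its mass in a
boundary shell. -/
theorem IsWeakSolution.interior_mass_le_shell_mass {Ω : Set E} {ρ : ℝ}
    (hρ : 0 < ρ) (hΩ : IsOpen Ω) (hne : Ω ≠ univ) (hbdd : Bornology.IsBounded Ω)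
    (hball : HasExteriorBalls Ω ρ)
    (b : OrthonormalBasis ι ℝ E) {W u : E → ℝ} (h : IsWeakSolution Ω W u) (hu : MemLp u 2)
    (huΩ : ∀ x ∉ Ω, u x = 0)
    (hW : ∀ S : Set E, IsCompact S → S ⊆ Ω → MemLp W ∞ (volume.restrict S))
    {G : ℝ → ℝ} (hG : ∀ t, 0 < t → DifferentiableAt ℝ G t)
    (hG' : ∀ t, 0 < t → 0 ≤ deriv G t ∧ deriv G t ≤ 1 / t) (hmono : MonotoneOn G (Ioi 0))
    {B : ℝ} (hB : ∀ t, 0 < t → G t ≤ B)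
    (hWG : ∀ᵐ x ∂volume.restrict Ω, deriv G (Metric.infDist x Ωᶜ) ^ 2 + 1 ≤
      1 / 4 * (1 / Metric.infDist x Ωᶜ ^ 2) - 3 / 4 * (Fintype.card ι / ρ) ^ 2 + W x)
    {c : ℝ} (hc : ∀ y, |deriv Real.smoothTransition y| ≤ c) {s ρ₀ : ℝ} (hs : 0 < s)
    (hsρ : s ≤ ρ₀) :
    Real.exp (2 * G ρ₀) * ∫ x in {x | ρ₀ ≤ Metric.infDist x Ωᶜ}, u x ^ 2 ≤
      Real.exp (2 * G s) * ((8 * c + 4 * c ^ 2) / s ^ 2) *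
        ∫ x in {x | s / 2 ≤ Metric.infDist x Ωᶜ ∧ Metric.infDist x Ωᶜ < s}, u x ^ 2 := by
  set δ : E → ℝ := fun y => Metric.infDist y Ωᶜ with hδdef
  have hδ : LipschitzWith 1 δ := Metric.lipschitz_infDist_pt Ωᶜ
  obtain ⟨C, hF⟩ := exists_lipschitzWith_agmonWeight hs hG hG' hB
  set f : E → ℝ := fun x => agmonWeight G s (δ x) with hfdef
  have hf : LipschitzWith (C * 1) f := hF.comp hδ
  obtain ⟨hK, hKΩ⟩ := isCompact_le_infDist_compl hbdd (half_pos hs)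
  have hfs : tsupport f ⊆ {x | s / 2 ≤ δ x} := by
    refine closure_minimal (fun x hx => ?_) hK.isClosed
    by_contra hn
    exact hx (agmonWeight_eq_zero hs (le_of_lt (not_le.1 hn)))
  have hfc : HasCompactSupport f := hK.of_isClosed_subset (isClosed_tsupport _) hfs
  have huc : HasCompactSupport u := by
    refine HasCompactSupport.of_support_subset_isCompact hbdd.isCompact_closure fun x hx => ?_
    by_contra hn
    exact hx (huΩ x fun hx' => hn (subset_closure hx'))
  obtain ⟨i1, i2, hen⟩ := h.localized_energy_inequality hρ hΩ hne hball b hu huc hW hf hfc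
    (hfs.trans hKΩ)
  set M := Real.exp (2 * G s) * ((8 * c + 4 * c ^ 2) / s ^ 2) with hM
  have hu2 := hu.integrable_sq
  have hm1 : MeasurableSet {x | ρ₀ ≤ δ x} :=
    measurableSet_le measurable_const hδ.continuous.measurable
  have hm2 : MeasurableSet {x | s / 2 ≤ δ x ∧ δ x < s} :=
    (measurableSet_le measurable_const hδ.continuous.measurable).inter
      (measurableSet_lt hδ.continuous.measurable measurable_const)
  -- On Ω, |∇f|² is at most G'(δ)²f² plus M on the shell, while the potential is at least G'(δ)² +
  -- 1. The surplus f²u² controls the interior mass, since f ≥ exp(G ρ₀) where ρ₀ ≤ δ.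
  have hpt : ∀ᵐ x, Real.exp (2 * G ρ₀) * {x | ρ₀ ≤ δ x}.indicator (fun x => u x ^ 2) x +
      (∑ i, lineDeriv ℝ f x (b i) ^ 2) * u x ^ 2 ≤
      (1 / 4 * (1 / δ x ^ 2) - 3 / 4 * (Fintype.card ι / ρ) ^ 2 + W x) * (f x * u x) ^ 2 +
        M * {x | s / 2 ≤ δ x ∧ δ x < s}.indicator (fun x => u x ^ 2) x := by
    filter_upwards [(ae_restrict_iff' hΩ.measurableSet).1 hWG, hδ.ae_differentiableAt]
      with x hx hdx
    by_cases hxΩ : x ∈ Ω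
    · have hgrad : ∑ i, lineDeriv ℝ f x (b i) ^ 2 = agmonWeightDeriv G s (δ x) ^ 2 := by
        have hd := (hasDerivAt_agmonWeight hs hG (δ x)).comp_hasFDerivAt x hdx.hasFDerivAt
        have : ∀ i, lineDeriv ℝ f x (b i) = agmonWeightDeriv G s (δ x) * fderiv ℝ δ x (b i) :=
          fun i => (hd.hasLineDerivAt (b i)).lineDeriv
        simp only [this, mul_pow]
        rw [← Finset.mul_sum, b.sum_apply_sq_eq_norm_sq,
          norm_fderiv_infDist_compl_eq_one hΩ hne hxΩ hdx, one_pow, mul_one]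
      have h1 := hx hxΩ
      have h2 := agmonWeightDeriv_sq_le hs hc hG' hmono (δ x)
      have h3 : {x | s / 2 ≤ δ x ∧ δ x < s}.indicator (fun x => u x ^ 2) x * M =
          (Ico (s / 2) s).indicator (fun _ => M) (δ x) * u x ^ 2 := by
        by_cases hsh : δ x ∈ Ico (s / 2) s
        · rw [indicator_of_mem hsh, indicator_of_mem (show x ∈ {x | s / 2 ≤ δ x ∧ δ x < s} from hsh),
            mul_comm]
        · rw [indicator_of_notMem hsh,
            indicator_of_notMem (show x ∉ {x | s / 2 ≤ δ x ∧ δ x < s} from hsh), zero_mul, zero_mul]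
      have h4 : Real.exp (2 * G ρ₀) * {x | ρ₀ ≤ δ x}.indicator (fun x => u x ^ 2) x ≤
          f x ^ 2 * u x ^ 2 := by
        by_cases hr : ρ₀ ≤ δ x
        · rw [indicator_of_mem (show x ∈ {x | ρ₀ ≤ δ x} from hr)]
          have : f x = Real.exp (G (δ x)) := agmonWeight_eq_exp hs (hsρ.trans hr)
          rw [this, ← Real.exp_nat_mul]
          have := hmono (show ρ₀ ∈ Ioi (0 : ℝ) from hs.trans_le hsρ)
            (show δ x ∈ Ioi (0 : ℝ) from hs.trans_le (hsρ.trans hr)) hr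
          push_cast
          gcongr
        · rw [indicator_of_notMem (show x ∉ {x | ρ₀ ≤ δ x} from hr), mul_zero]
          positivity
      rw [hgrad, mul_comm M, h3]
      have h5 := mul_le_mul_of_nonneg_right h2 (sq_nonneg (u x))
      have h6 := mul_le_mul_of_nonneg_right h1 (sq_nonneg (f x * u x))
      have h7 : agmonWeight G s (δ x) = f x := rfl
      rw [h7] at h5
      simp only [hδdef] at h4 h5 h6 ⊢
      nlinarith
    · have : {x | ρ₀ ≤ δ x}.indicator (fun x => u x ^ 2) x = 0 := by
        rw [indicator_apply_eq_zero]; intro _; rw [huΩ x hxΩ]; simp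
      have h' : {x | s / 2 ≤ δ x ∧ δ x < s}.indicator (fun x => u x ^ 2) x = 0 := by
        rw [indicator_apply_eq_zero]; intro _; rw [huΩ x hxΩ]; simp
      rw [this, h', huΩ x hxΩ]
      simp
  have j1 : Integrable (fun x => Real.exp (2 * G ρ₀) *
      {x | ρ₀ ≤ δ x}.indicator (fun x => u x ^ 2) x) := (hu2.indicator hm1).const_mul _
  have j2 : Integrable (fun x => M *
      {x | s / 2 ≤ δ x ∧ δ x < s}.indicator (fun x => u x ^ 2) x) := (hu2.indicator hm2).const_mul _
  have hfin := integral_mono_ae (j1.add i2) (i1.add j2) hpt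
  rw [integral_add' j1 i2, integral_add' i1 j2, integral_const_mul, integral_const_mul,
    integral_indicator hm1, integral_indicator hm2] at hfin
  linarith

end Decay

/-! ### Vanishing of square integrable solutions under condition (Σ). -/

section Vanishing

variable {ι E : Type*} [Fintype ι] [NormedAddCommGroup E] [InnerProductSpace ℝ E]
  [FiniteDimensional ℝ E] [MeasurableSpace E] [BorelSpace E]

/-- Square integrable weak solutions vanish when the potential is confining. -/
theorem IsWeakSolution.ae_eq_zero {Ω : Set E} {ρ : ℝ}
    (hρ : 0 < ρ) (hΩ : IsOpen Ω) (hne : Ω ≠ univ) (hbdd : Bornology.IsBounded Ω)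
    (hball : HasExteriorBalls Ω ρ)
    (b : OrthonormalBasis ι ℝ E) {W u : E → ℝ} (h : IsWeakSolution Ω W u) (hu : MemLp u 2)
    (huΩ : ∀ x ∉ Ω, u x = 0)
    (hW : ∀ S : Set E, IsCompact S → S ⊆ Ω → MemLp W ∞ (volume.restrict S))
    {G : ℝ → ℝ} (hG : ConditionSigma G)
    (hWG : ∀ᵐ x ∂volume.restrict Ω, deriv G (Metric.infDist x Ωᶜ) ^ 2 + 1 ≤
      1 / 4 * (1 / Metric.infDist x Ωᶜ ^ 2) - 3 / 4 * (Fintype.card ι / ρ) ^ 2 + W x) :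
    u =ᵐ[volume] 0 := by
  obtain ⟨hGc, d₀, hd₀, hG1, hG2, hG3⟩ := hG
  have hd : ∀ t, 0 < t → DifferentiableAt ℝ G t := fun t ht =>
    (hGc.contDiffAt (Ioi_mem_nhds ht)).differentiableAt one_ne_zero
  have hG' : ∀ t, 0 < t → 0 ≤ deriv G t ∧ deriv G t ≤ 1 / t := by
    intro t ht
    rcases lt_or_ge t d₀ with h1 | h1
    · exact hG1 t ht h1
    · rw [hG2 t h1]
      exact ⟨le_rfl, by positivity⟩
  have hmono : MonotoneOn G (Ioi 0) :=
    monotoneOn_of_deriv_nonneg (convex_Ioi 0)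
      (fun t ht => (hd t ht).continuousAt.continuousWithinAt)
      (fun t ht => (hd t (by simpa using ht)).differentiableWithinAt)
      (fun t ht => (hG' t (by simpa using ht)).1)
  have hanti : AntitoneOn G (Ici d₀) :=
    antitoneOn_of_deriv_nonpos (convex_Ici d₀)
      (fun t ht => (hd t (hd₀.trans_le ht)).continuousAt.continuousWithinAt)
      (fun t ht => (hd t (hd₀.trans_le (interior_subset ht))).differentiableWithinAt)
      (fun t ht => (hG2 t (interior_subset ht)).le)
  have hB : ∀ t, 0 < t → G t ≤ G d₀ := by
    intro t ht
    rcases le_total t d₀ with h1 | h1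
    · exact hmono ht hd₀ h1
    · exact hanti self_mem_Ici h1 h1
  obtain ⟨c, hc0, hc⟩ := exists_abs_deriv_smoothTransition_le
  have hu2 := hu.integrable_sq
  set δ : E → ℝ := fun x => Metric.infDist x Ωᶜ with hδ
  have hδm : Measurable δ := (Metric.continuous_infDist_pt Ωᶜ).measurable
  have hzero : ∀ ρ₀, 0 < ρ₀ → ρ₀ ≤ d₀ / 2 → ∫ x in {x | ρ₀ ≤ δ x}, u x ^ 2 = 0 := by
    intro ρ₀ hρ₀ hρ₀d
    -- Dyadic shells. The lower end of each is the excluded upper end of the next, so they are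
    -- disjoint and their masses sum to at most that of u.
    set T : ℕ → Set E := fun k =>
      {x | ((2 : ℝ) ^ k)⁻¹ * ρ₀ / 2 ≤ δ x ∧ δ x < ((2 : ℝ) ^ k)⁻¹ * ρ₀} with hT
    have hTm : ∀ k, MeasurableSet (T k) := fun k =>
      (measurableSet_le measurable_const hδm).inter (measurableSet_lt hδm measurable_const)
    have hTlt : ∀ j k, j < k → Disjoint (T j) (T k) := by
      intro j k hjk
      rw [Set.disjoint_left]
      intro x hxj hxk
      have h1 : ((2 : ℝ) ^ k)⁻¹ ≤ ((2 : ℝ) ^ (j + 1))⁻¹ :=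
        inv_anti₀ (by positivity) (pow_le_pow_right₀ one_le_two hjk)
      have h2 : ((2 : ℝ) ^ (j + 1))⁻¹ = ((2 : ℝ) ^ j)⁻¹ / 2 := by
        rw [pow_succ, mul_inv]; rfl
      have h3 : ((2 : ℝ) ^ k)⁻¹ * ρ₀ ≤ ((2 : ℝ) ^ j)⁻¹ / 2 * ρ₀ := by
        rw [← h2]; gcongr
      have h4 := hxj.1
      have h5 := hxk.2
      linarith
    have hTd : ∀ s : Set ℕ, s.Pairwise (Function.onFun Disjoint T) := by
      intro s j _ k _ hjk
      rcases lt_or_gt_of_ne hjk with h1 | h1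
      · exact hTlt j k h1
      · exact (hTlt k j h1).symm
    have hsum : ∀ N : ℕ, ∑ k ∈ Finset.Icc 1 N, ∫ x in T k, u x ^ 2 ≤ ∫ x, u x ^ 2 := by
      intro N
      rw [← integral_biUnion_finset _ (fun k _ => hTm k) (hTd _) fun k _ => hu2.integrableOn]
      exact setIntegral_le_integral hu2 (Eventually.of_forall fun x => sq_nonneg _)
    set A := ∫ x in {x | ρ₀ ≤ δ x}, u x ^ 2 with hA
    have hA0 : 0 ≤ A := integral_nonneg fun x => sq_nonneg _
    set C := 8 * c + 4 * c ^ 2 with hC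
    have hC0 : 0 < C := by positivity
    -- Solving the Agmon estimate at s = 2⁻ᵏρ₀ for the shell mass, s² = 4⁻ᵏρ₀² produces the k-th
    -- summand of (Σ); κ collects the factors independent of k.
    set κ := Real.exp (2 * G ρ₀) * A * ρ₀ ^ 2 / C with hκ
    have hterm : ∀ k, κ * (((4 : ℝ) ^ k)⁻¹ * Real.exp (-2 * G (((2 : ℝ) ^ k)⁻¹ * ρ₀))) ≤
        ∫ x in T k, u x ^ 2 := by
      intro k
      set s := ((2 : ℝ) ^ k)⁻¹ * ρ₀ with hs
      have hs0 : 0 < s := by positivity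
      have hsρ : s ≤ ρ₀ := mul_le_of_le_one_left hρ₀.le (inv_le_one_of_one_le₀ (one_le_pow₀ one_le_two))
      have := h.interior_mass_le_shell_mass hρ hΩ hne hbdd hball b hu huΩ hW hd hG' hmono hB hWG
        hc hs0 hsρ
      have hs2 : s ^ 2 = ((4 : ℝ) ^ k)⁻¹ * ρ₀ ^ 2 := by
        rw [hs, mul_pow, inv_pow, ← pow_mul, mul_comm k 2, pow_mul]; norm_num
      have he : Real.exp (-2 * G s) * Real.exp (2 * G s) = 1 := by
        rw [← Real.exp_add]; simp
      have e1 : κ * (((4 : ℝ) ^ k)⁻¹ * Real.exp (-2 * G s)) =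
          Real.exp (2 * G ρ₀) * A * (Real.exp (-2 * G s) * (s ^ 2 / C)) := by
        rw [hκ, hs2]; ring
      rw [e1]
      calc Real.exp (2 * G ρ₀) * A * (Real.exp (-2 * G s) * (s ^ 2 / C))
          ≤ (Real.exp (2 * G s) * (C / s ^ 2) * ∫ x in T k, u x ^ 2) *
            (Real.exp (-2 * G s) * (s ^ 2 / C)) :=
            mul_le_mul_of_nonneg_right this (by positivity)
        _ = (Real.exp (-2 * G s) * Real.exp (2 * G s)) * ∫ x in T k, u x ^ 2 := by
            field_simp
        _ = _ := by rw [he, one_mul]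
    have hbound : ∀ N : ℕ, κ * ∑ k ∈ Finset.Icc 1 N,
        ((4 : ℝ) ^ k)⁻¹ * Real.exp (-2 * G (((2 : ℝ) ^ k)⁻¹ * ρ₀)) ≤ ∫ x, u x ^ 2 := by
      intro N
      rw [Finset.mul_sum]
      exact (Finset.sum_le_sum fun k _ => hterm k).trans (hsum N)
    -- A positive A would make κ positive, and the divergent series would exceed the finite mass of
    -- u.
    by_contra hne0
    have hApos : 0 < A := lt_of_le_of_ne hA0 (Ne.symm hne0)
    have hκ0 : 0 < κ := by positivity
    have htend := (hG3 ρ₀ hρ₀ hρ₀d).const_mul_atTop hκ0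
    obtain ⟨N, hN⟩ := (htend.eventually_gt_atTop (∫ x, u x ^ 2)).exists
    exact absurd (hbound N) (not_le.2 hN)
  -- Exhaust Ω by superlevel sets of δ whose thresholds tend to 0 and never exceed d₀/2.
  have hae : ∀ k : ℕ, ∀ᵐ x, d₀ / 2 / (k + 1) ≤ δ x → u x = 0 := by
    intro k
    have hk : (0 : ℝ) < k + 1 := by positivity
    have h0 := hzero (d₀ / 2 / (k + 1)) (by positivity)
      (div_le_self (by positivity) (by linarith [(Nat.cast_nonneg k : (0 : ℝ) ≤ k)]))
    rw [setIntegral_eq_zero_iff_of_nonneg_ae (Eventually.of_forall fun x => sq_nonneg _)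
      hu2.integrableOn] at h0
    have h1 := (ae_restrict_iff' (measurableSet_le measurable_const hδm)).1 h0
    filter_upwards [h1] with x hx hx'
    simpa using hx hx'
  filter_upwards [ae_all_iff.2 hae] with x hx
  by_cases hxΩ : x ∈ Ω
  · have hpos : 0 < δ x :=
      (hΩ.isClosed_compl.notMem_iff_infDist_pos (nonempty_compl.2 hne)).1 (not_not.2 hxΩ)
    have hlim : Tendsto (fun k : ℕ => d₀ / 2 * (1 / ((k : ℝ) + 1))) atTop (𝓝 0) := by
      simpa using tendsto_one_div_add_atTop_nhds_zero_nat.const_mul (d₀ / 2)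
    obtain ⟨k, hk⟩ := (hlim.eventually (gt_mem_nhds hpos)).exists
    exact hx k (by rw [div_eq_mul_one_div]; exact hk.le)
  · exact huΩ x hxΩ

end Vanishing

/-! ### Coercivity on real test functions. -/

section Coercivity

theorem continuous_laplacian {E : Type*} [NormedAddCommGroup E] [InnerProductSpace ℝ E]
    [FiniteDimensional ℝ E] {u : E → ℝ} (hu : ContDiff ℝ 2 u) :
    Continuous (Laplacian.laplacian u) := by
  rw [InnerProductSpace.laplacian_eq_iteratedFDeriv_orthonormalBasis u (stdOrthonormalBasis ℝ E)]
  exact continuous_finsetSum _ fun i _ =>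
    (hu.continuous_iteratedFDeriv (m := 2) le_rfl).eval_const _

theorem hasCompactSupport_laplacian {E : Type*} [NormedAddCommGroup E] [InnerProductSpace ℝ E]
    [FiniteDimensional ℝ E] {u : E → ℝ} (hc : HasCompactSupport u) :
    HasCompactSupport (Laplacian.laplacian u) := by
  refine (hc.iteratedFDeriv (𝕜 := ℝ) 2).mono fun x hx => ?_
  contrapose! hx
  simp only [Function.mem_support, not_not] at hx ⊢
  rw [InnerProductSpace.laplacian_eq_iteratedFDeriv_orthonormalBasis u (stdOrthonormalBasis ℝ E)]
  simp [hx]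

variable {ι E : Type*} [Fintype ι] [NormedAddCommGroup E] [InnerProductSpace ℝ E]
  [FiniteDimensional ℝ E] [MeasurableSpace E] [BorelSpace E]

theorem integrable_mul_of_memLp_top {Ω : Set E} {W a : E → ℝ}
    (hW : ∀ S : Set E, IsCompact S → S ⊆ Ω → MemLp W ∞ (volume.restrict S))
    (ha : Continuous a) (hc : HasCompactSupport a) (hsupp : tsupport a ⊆ Ω) :
    Integrable (fun x => W x * a x) := by
  have h := hW _ hc hsupp
  have ha1 : Integrable a (volume.restrict (tsupport a)) :=
    (ha.integrable_of_hasCompactSupport hc).restrict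
  have : IntegrableOn (fun x => W x * a x) (tsupport a) := ha1.mul_of_top_right h
  refine (integrableOn_iff_integrable_of_support_subset fun x hx => ?_).1 this
  exact subset_tsupport _ (right_ne_zero_of_mul hx)

/-- Green's formula turns -∫ a Δa into the Dirichlet integral; Hardy's inequality then reduces the
claim to the pointwise bound `hWG`. -/
theorem integral_sq_le_integral_schrodinger {Ω : Set E} {ρ : ℝ}
    (hρ : 0 < ρ) (hΩ : IsOpen Ω) (hne : Ω ≠ univ) (hball : HasExteriorBalls Ω ρ)
    (b : OrthonormalBasis ι ℝ E) {W : E → ℝ}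
    (hW : ∀ S : Set E, IsCompact S → S ⊆ Ω → MemLp W ∞ (volume.restrict S))
    (hWG : ∀ᵐ x ∂volume.restrict Ω, 1 ≤
      1 / 4 * (1 / Metric.infDist x Ωᶜ ^ 2) - 3 / 4 * (Fintype.card ι / ρ) ^ 2 + W x)
    {a : E → ℝ} (ha : ContDiff ℝ 2 a) (hc : HasCompactSupport a) (hsupp : tsupport a ⊆ Ω) :
    Integrable (fun x => a x * (-Laplacian.laplacian a x + W x * a x)) ∧
      ∫ x, a x ^ 2 ≤ ∫ x, a x * (-Laplacian.laplacian a x + W x * a x) := by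
  obtain ⟨C, hC⟩ := (ha.of_le one_le_two).lipschitzWith_of_hasCompactSupport hc (by simp)
  have hardy := hardy_inequality hρ hΩ hne hball b hC hc hsupp
  have hibp := integral_sum_lineDeriv_mul_eq_neg_laplacian b ha hc hC hc
  simp only [← sq] at hibp
  rw [hibp] at hardy
  have hcs : HasCompactSupport (fun x => a x ^ 2) := by
    simp only [sq]; exact hc.mul_left
  have hts : tsupport (fun x => a x ^ 2) ⊆ Ω := by
    simp only [sq]; exact tsupport_mul_subset_left.trans hsupp
  have i1 : Integrable (fun x => a x * Laplacian.laplacian a x) :=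
    (ha.continuous.mul (continuous_laplacian ha)).integrable_of_hasCompactSupport hc.mul_right
  have i2 : Integrable (fun x => W x * a x ^ 2) :=
    integrable_mul_of_memLp_top hW (ha.continuous.pow 2) hcs hts
  have i3 : Integrable (fun x => a x ^ 2) :=
    (ha.continuous.pow 2).integrable_of_hasCompactSupport hcs
  have e : ∀ x, a x * (-Laplacian.laplacian a x + W x * a x) =
      -(a x * Laplacian.laplacian a x) + W x * a x ^ 2 := fun x => by ring
  simp only [e]
  refine ⟨i1.neg.add i2, ?_⟩
  obtain ⟨s, hs, hlt⟩ := exists_pos_lt_infDist_compl hΩ hne hc hsupp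
  have i4 : Integrable (fun x =>
      (1 / 4 * (1 / Metric.infDist x Ωᶜ ^ 2) - 3 / 4 * (Fintype.card ι / ρ) ^ 2) * a x ^ 2) := by
    have : Integrable (fun x => (1 / 4 * (1 / max (Metric.infDist x Ωᶜ) s ^ 2)
        - 3 / 4 * (Fintype.card ι / ρ) ^ 2) * a x ^ 2) := by
      refine Continuous.integrable_of_hasCompactSupport ?_ hcs.mul_left
      have : ∀ x, max (Metric.infDist x Ωᶜ) s ^ 2 ≠ 0 := fun x =>
        (pow_pos (hs.trans_le (le_max_right _ _)) 2).ne'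
      have hac := ha.continuous
      have hcδ : Continuous fun x => Metric.infDist x Ωᶜ := Metric.continuous_infDist_pt Ωᶜ
      fun_prop (disch := assumption)
    refine this.congr (Eventually.of_forall fun x => ?_)
    by_cases hx : x ∈ tsupport a
    · simp only [max_eq_left (hlt x hx).le]
    · simp [image_eq_zero_of_notMem_tsupport hx]
  have hle : ∫ x, a x ^ 2 ≤ ∫ x,
      ((1 / 4 * (1 / Metric.infDist x Ωᶜ ^ 2) - 3 / 4 * (Fintype.card ι / ρ) ^ 2) * a x ^ 2 +
        W x * a x ^ 2) := by
    refine integral_mono_ae i3 (i4.add i2) ?_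
    filter_upwards [(ae_restrict_iff' hΩ.measurableSet).1 hWG] with x hx
    by_cases hxΩ : x ∈ Ω
    · have := mul_le_mul_of_nonneg_right (hx hxΩ) (sq_nonneg (a x))
      linarith
    · simp [image_eq_zero_of_notMem_tsupport fun h => hxΩ (hsupp h)]
  rw [integral_add i4 i2] at hle
  rw [integral_add (f := fun x => -(a x * Laplacian.laplacian a x)) i1.neg i2, integral_neg]
  linarith

end Coercivity

/-! ### The Schrödinger operator in L²(Ω): density, symmetry, reduction to real functions. -/

section Schrodinger

variable {n : ℕ} {Ω : Opens (EuclideanSpace ℝ (Fin n))} {V : EuclideanSpace ℝ (Fin n) → ℝ}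

theorem LocallyLInfty.sub_const (hV : LocallyLInfty Ω V) (e : ℝ) :
    LocallyLInfty Ω (fun x => V x - e) := by
  intro S hS hSΩ
  have : IsFiniteMeasure (volume.restrict S) := ⟨by
    rw [Measure.restrict_apply_univ]; exact hS.measure_lt_top⟩
  exact (hV S hS hSΩ).sub (memLp_const e)

/-- A spectral shift is a change of potential, so H - e is treated as the operator with potential V
- e. -/
theorem schrodingerFun_sub_const (e : ℝ) (φ : EuclideanSpace ℝ (Fin n) → ℂ)
    (x : EuclideanSpace ℝ (Fin n)) :
    schrodingerFun V φ x - (e : ℂ) * φ x = schrodingerFun (fun x => V x - e) φ x := by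
  simp only [schrodingerFun, Complex.ofReal_sub]
  ring

theorem schrodingerMap_sub_smul_ae_eq (hV : LocallyLInfty Ω V) (e : ℝ) (φ : 𝓓(Ω, ℂ)) :
    (schrodingerMap hV φ - (e : ℂ) • testToL2 Ω φ : L2 Ω) =ᵐ[volume.restrict (Ω : Set _)]
      schrodingerFun (fun x => V x - e) φ := by
  filter_upwards [Lp.coeFn_sub (schrodingerMap hV φ) ((e : ℂ) • testToL2 Ω φ),
    Lp.coeFn_smul (e : ℂ) (testToL2 Ω φ), (schrodingerFun_memLp hV φ).coeFn_toLp,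
    (testFunction_memLp φ).coeFn_toLp] with x h1 h2 h3 h4
  rw [h1, Pi.sub_apply, h2, Pi.smul_apply, ← schrodingerFun_sub_const, ← h3, ← h4]
  rfl

theorem inner_schrodingerMap_sub_smul (hV : LocallyLInfty Ω V) (e : ℝ) (ψ : L2 Ω) (φ : 𝓓(Ω, ℂ)) :
    inner ℂ ψ (schrodingerMap hV φ - (e : ℂ) • testToL2 Ω φ) =
      ∫ x in (Ω : Set _), schrodingerFun (fun x => V x - e) φ x * (starRingEnd ℂ) (ψ x) := by
  rw [L2.inner_def]
  refine integral_congr_ae ?_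
  filter_upwards [schrodingerMap_sub_smul_ae_eq hV e φ] with x hx
  rw [hx, RCLike.inner_apply]

theorem exists_of_mem_schrodingerOp_domain (hV : LocallyLInfty Ω V)
    (x : (schrodingerOp Ω V hV).domain) : ∃ φ : 𝓓(Ω, ℂ), testToL2 Ω φ = x ∧
      schrodingerOp Ω V hV x = schrodingerMap hV φ := by
  obtain ⟨_, φ, rfl⟩ := x
  exact ⟨φ, rfl, schrodingerOp_apply Ω V hV φ⟩

/-- A real test function, viewed as complex-valued. -/
noncomputable def testOfReal (θ : EuclideanSpace ℝ (Fin n) → ℝ) (hθ : ContDiff ℝ (⊤ : ℕ∞) θ)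
    (hc : HasCompactSupport θ) (hs : tsupport θ ⊆ Ω) : 𝓓(Ω, ℂ) where
  toFun x := (θ x : ℂ)
  contDiff' := Complex.ofRealCLM.contDiff.comp hθ
  hasCompactSupport' := hc.comp_left (g := fun t : ℝ => (t : ℂ)) Complex.ofReal_zero
  tsupport_subset' := by
    refine subset_trans (closure_mono fun x hx => ?_) hs
    simpa using hx

theorem testOfReal_apply (θ : EuclideanSpace ℝ (Fin n) → ℝ) (hθ : ContDiff ℝ (⊤ : ℕ∞) θ)
    (hc : HasCompactSupport θ) (hs : tsupport θ ⊆ Ω) (x : EuclideanSpace ℝ (Fin n)) :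
    testOfReal θ hθ hc hs x = (θ x : ℂ) := rfl

theorem contDiff_two_of_top {F : Type*} [NormedAddCommGroup F] [NormedSpace ℝ F]
    {θ : EuclideanSpace ℝ (Fin n) → F} (hθ : ContDiff ℝ (⊤ : ℕ∞) θ) : ContDiff ℝ 2 θ :=
  hθ.of_le (WithTop.coe_le_coe.2 (le_top : (2 : ℕ∞) ≤ ⊤))

theorem schrodingerFun_testOfReal (W θ : EuclideanSpace ℝ (Fin n) → ℝ)
    (hθ : ContDiff ℝ (⊤ : ℕ∞) θ)
    (hc : HasCompactSupport θ) (hs : tsupport θ ⊆ Ω) (x : EuclideanSpace ℝ (Fin n)) :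
    schrodingerFun W (testOfReal θ hθ hc hs) x =
      ((-Laplacian.laplacian θ x + W x * θ x : ℝ) : ℂ) := by
  have h := ((contDiff_two_of_top hθ).contDiffAt (x := x)).laplacian_CLM_comp_left
    (l := Complex.ofRealCLM)
  have h' : Laplacian.laplacian (testOfReal θ hθ hc hs : EuclideanSpace ℝ (Fin n) → ℂ) x =
      (Laplacian.laplacian θ x : ℂ) := h
  rw [schrodingerFun, h', testOfReal_apply]
  push_cast
  rfl

/-- A vector orthogonal to all real test functions vanishes by the fundamental lemma of the calculus
of variations. -/
theorem dense_range_testToL2 (Ω : Opens (EuclideanSpace ℝ (Fin n))) :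
    Dense (LinearMap.range (testToL2 Ω) : Set (L2 Ω)) := by
  rw [Submodule.dense_iff_topologicalClosure_eq_top,
    Submodule.topologicalClosure_eq_top_iff, Submodule.eq_bot_iff]
  intro ψ hψ
  rw [Submodule.mem_orthogonal] at hψ
  have hloc : LocallyIntegrableOn ψ (Ω : Set (EuclideanSpace ℝ (Fin n))) := by
    rw [locallyIntegrableOn_iff Ω.isOpen.isLocallyClosed]
    intro k hk hkc
    have : IsFiniteMeasure (volume.restrict k) := ⟨by
      rw [Measure.restrict_apply_univ]; exact hkc.measure_lt_top⟩
    have h2 : MemLp ψ 2 (volume.restrict k) := (Lp.memLp ψ).mono_measure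
      (Measure.restrict_mono hk le_rfl)
    exact h2.integrable one_le_two
  have key := Ω.isOpen.ae_eq_zero_of_integral_contDiff_smul_eq_zero hloc ?_
  · rw [Lp.ext_iff]
    filter_upwards [(ae_restrict_iff' Ω.isOpen.measurableSet).2 key,
      Lp.coeFn_zero ℂ 2 (volume.restrict (Ω : Set (EuclideanSpace ℝ (Fin n))))] with x h1 h2
    rw [h1, h2]; rfl
  · intro θ hθ hc hs
    have h := hψ _ ⟨testOfReal θ hθ hc hs, rfl⟩
    rw [L2.inner_def] at h
    rw [← setIntegral_eq_integral_of_forall_compl_eq_zero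
      (s := (Ω : Set (EuclideanSpace ℝ (Fin n))))]
    · rw [← h]
      refine integral_congr_ae ?_
      filter_upwards [(testFunction_memLp (testOfReal θ hθ hc hs)).coeFn_toLp] with x hx
      have : (testToL2 Ω (testOfReal θ hθ hc hs)) x = (θ x : ℂ) := hx
      rw [this, RCLike.inner_apply, Complex.conj_ofReal, mul_comm, Complex.real_smul]
    · intro x hx
      rw [image_eq_zero_of_notMem_tsupport fun h => hx (hs h), zero_smul]

/-- Test functions are Schwartz functions on the whole space, where the Laplacian may be moved
across the pairing. -/
theorem integral_conj_mul_laplacian_eq (φ ψ : 𝓓(Ω, ℂ)) :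
    ∫ x, (starRingEnd ℂ) (φ x) * Laplacian.laplacian (ψ : EuclideanSpace ℝ (Fin n) → ℂ) x =
      ∫ x, (starRingEnd ℂ) (Laplacian.laplacian (φ : EuclideanSpace ℝ (Fin n) → ℂ) x) * ψ x := by
  have hcφ : HasCompactSupport (fun x => (starRingEnd ℂ) (φ x)) :=
    φ.hasCompactSupport.comp_left (map_zero _)
  have hdφ : ContDiff ℝ (⊤ : ℕ∞) (fun x => (starRingEnd ℂ) (φ x)) :=
    Complex.conjCLE.contDiff.comp φ.contDiff
  have h := SchwartzMap.integral_mul_laplacian_right_eq_left (μ := volume)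
    (hcφ.toSchwartzMap hdφ) (ψ.hasCompactSupport.toSchwartzMap ψ.contDiff)
  simp only [SchwartzMap.laplacian_apply] at h
  have hc : ∀ x, Laplacian.laplacian (fun x => (starRingEnd ℂ) (φ x)) x =
      (starRingEnd ℂ) (Laplacian.laplacian (φ : EuclideanSpace ℝ (Fin n) → ℂ) x) := fun x =>
    (testFunction_contDiffAt φ x).laplacian_CLM_comp_left (l := (Complex.conjCLE : ℂ →L[ℝ] ℂ))
  rw [← integral_congr_ae (Eventually.of_forall fun x => congrArg (· * ψ x) (hc x))]
  exact h

theorem schrodingerOp_isFormalAdjoint (hV : LocallyLInfty Ω V) :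
    (schrodingerOp Ω V hV).IsFormalAdjoint (schrodingerOp Ω V hV) := by
  intro y x
  obtain ⟨φ, hφ, hHφ⟩ := exists_of_mem_schrodingerOp_domain hV y
  obtain ⟨ψ, hψ, hHψ⟩ := exists_of_mem_schrodingerOp_domain hV x
  rw [hHφ, hHψ, ← hφ, ← hψ, L2.inner_def, L2.inner_def]
  have e1 : ∫ a in (Ω : Set _), inner ℂ (schrodingerMap hV φ a) (testToL2 Ω ψ a) =
      ∫ a in (Ω : Set _), (starRingEnd ℂ) (schrodingerFun V φ a) * ψ a := by
    refine integral_congr_ae ?_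
    filter_upwards [(schrodingerFun_memLp hV φ).coeFn_toLp, (testFunction_memLp ψ).coeFn_toLp]
      with a h1 h2
    have h1' : schrodingerMap hV φ a = schrodingerFun V φ a := h1
    have h2' : testToL2 Ω ψ a = ψ a := h2
    rw [h1', h2', RCLike.inner_apply, mul_comm]
  have e2 : ∫ a in (Ω : Set _), inner ℂ (testToL2 Ω φ a) (schrodingerMap hV ψ a) =
      ∫ a in (Ω : Set _), (starRingEnd ℂ) (φ a) * schrodingerFun V ψ a := by
    refine integral_congr_ae ?_
    filter_upwards [(schrodingerFun_memLp hV ψ).coeFn_toLp, (testFunction_memLp φ).coeFn_toLp]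
      with a h1 h2
    have h1' : schrodingerMap hV ψ a = schrodingerFun V ψ a := h1
    have h2' : testToL2 Ω φ a = φ a := h2
    rw [h1', h2', RCLike.inner_apply, mul_comm]
  have hL : ∫ a in (Ω : Set _), (starRingEnd ℂ) (φ a) *
        Laplacian.laplacian (ψ : EuclideanSpace ℝ (Fin n) → ℂ) a =
      ∫ a in (Ω : Set _), (starRingEnd ℂ)
        (Laplacian.laplacian (φ : EuclideanSpace ℝ (Fin n) → ℂ) a) * ψ a := by
    rw [setIntegral_eq_integral_of_forall_compl_eq_zero,
      setIntegral_eq_integral_of_forall_compl_eq_zero, integral_conj_mul_laplacian_eq]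
    · intro x hx
      rw [image_eq_zero_of_notMem_tsupport fun h => hx (ψ.tsupport_subset h), mul_zero]
    · intro x hx
      rw [image_eq_zero_of_notMem_tsupport fun h => hx (φ.tsupport_subset h), map_zero, zero_mul]
  have i1 : Integrable (fun a => (starRingEnd ℂ) (φ a) *
      Laplacian.laplacian (ψ : EuclideanSpace ℝ (Fin n) → ℂ) a) (volume.restrict (Ω : Set _)) :=
    (testFunction_memLp φ).star.integrable_mul (testFunction_laplacian_memLp ψ)
  have i2 : Integrable (fun a => (starRingEnd ℂ)
      (Laplacian.laplacian (φ : EuclideanSpace ℝ (Fin n) → ℂ) a) * ψ a)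
      (volume.restrict (Ω : Set _)) :=
    (testFunction_laplacian_memLp φ).star.integrable_mul (testFunction_memLp ψ)
  have i3 : Integrable (fun a => (starRingEnd ℂ) (φ a) * schrodingerFun V ψ a)
      (volume.restrict (Ω : Set _)) :=
    (testFunction_memLp φ).star.integrable_mul (schrodingerFun_memLp hV ψ)
  have i4 : Integrable (fun a => (starRingEnd ℂ) (schrodingerFun V φ a) * ψ a)
      (volume.restrict (Ω : Set _)) :=
    (schrodingerFun_memLp hV φ).star.integrable_mul (testFunction_memLp ψ)
  rw [e1, e2]
  -- Adding this integral to both sides cancels the Laplacians and leaves the integral of V φ̄ ψ on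
  -- each, as V is real.
  refine add_right_cancel (b := ∫ a in (Ω : Set _), (starRingEnd ℂ)
    (Laplacian.laplacian (φ : EuclideanSpace ℝ (Fin n) → ℂ) a) * ψ a) ?_
  rw [← integral_add i4 i2, ← hL, ← integral_add i3 i1]
  refine integral_congr_ae (Eventually.of_forall fun a => ?_)
  simp only [schrodingerFun, map_add, map_neg, map_mul, Complex.conj_ofReal]
  ring

theorem isWeakSolution_of_integral_eq_zero {W v : EuclideanSpace ℝ (Fin n) → ℝ}
    (hW : LocallyLInfty Ω W)
    (hv : MemLp v 2 (volume.restrict (Ω : Set (EuclideanSpace ℝ (Fin n)))))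
    (h : ∀ θ : EuclideanSpace ℝ (Fin n) → ℝ, ContDiff ℝ (⊤ : ℕ∞) θ → HasCompactSupport θ →
      tsupport θ ⊆ Ω →
        ∫ x in (Ω : Set _), (-Laplacian.laplacian θ x + W x * θ x) * v x = 0) :
    IsWeakSolution (Ω : Set (EuclideanSpace ℝ (Fin n))) W
      ((Ω : Set (EuclideanSpace ℝ (Fin n))).indicator v) := by
  intro θ hθ hc hs
  have hΩ := Ω.isOpen.measurableSet
  have hθ2 := contDiff_two_of_top hθ
  have i1 : Integrable (fun x => v x * Laplacian.laplacian θ x)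
      (volume.restrict (Ω : Set (EuclideanSpace ℝ (Fin n)))) :=
    hv.integrable_mul (q := 2) ((continuous_laplacian hθ2).memLp_of_hasCompactSupport
      (hasCompactSupport_laplacian hc))
  have i2 : Integrable (fun x => v x * (W x * θ x))
      (volume.restrict (Ω : Set (EuclideanSpace ℝ (Fin n)))) := by
    refine hv.integrable_mul (q := 2) ?_
    -- W θ is square integrable as the sum of -Δθ + W θ and Δθ.
    have hm := ((schrodingerFun_memLp hW (testOfReal θ hθ hc hs)).re).add
      ((continuous_laplacian hθ2).memLp_of_hasCompactSupport (hasCompactSupport_laplacian hc)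
        (μ := volume.restrict (Ω : Set (EuclideanSpace ℝ (Fin n)))))
    refine hm.congr_norm (hm.aestronglyMeasurable.congr (Eventually.of_forall fun x => ?_))
      (Eventually.of_forall fun x => ?_) <;>
    simp [schrodingerFun_testOfReal]
  have e : ∀ g : EuclideanSpace ℝ (Fin n) → ℝ,
      ∫ x, (Ω : Set (EuclideanSpace ℝ (Fin n))).indicator v x * g x =
        ∫ x in (Ω : Set (EuclideanSpace ℝ (Fin n))), v x * g x := by
    intro g
    rw [← integral_indicator hΩ]
    simp only [indicator_mul_left]
  rw [e, e]
  have h0 := h θ hθ hc hs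
  have e2 : ∀ x, (-Laplacian.laplacian θ x + W x * θ x) * v x =
      v x * (W x * θ x) - v x * Laplacian.laplacian θ x := fun x => by ring
  simp only [e2] at h0
  rw [integral_sub i2 i1] at h0
  linarith

/-- The potential is real, so testing with real functions separates real and imaginary parts of the
equation. -/
theorem isWeakSolution_re_im_of_orthogonal (hV : LocallyLInfty Ω V) (e : ℝ) (ψ : L2 Ω)
    (h : ∀ φ : 𝓓(Ω, ℂ), inner ℂ ψ (schrodingerMap hV φ - (e : ℂ) • testToL2 Ω φ) = 0) :
    IsWeakSolution (Ω : Set (EuclideanSpace ℝ (Fin n))) (fun x => V x - e)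
        ((Ω : Set (EuclideanSpace ℝ (Fin n))).indicator fun x => (ψ x).re) ∧
      IsWeakSolution (Ω : Set (EuclideanSpace ℝ (Fin n))) (fun x => V x - e)
        ((Ω : Set (EuclideanSpace ℝ (Fin n))).indicator fun x => (ψ x).im) := by
  have hψ := Lp.memLp ψ
  have hWe := hV.sub_const e
  have key : ∀ θ : EuclideanSpace ℝ (Fin n) → ℝ, ContDiff ℝ (⊤ : ℕ∞) θ → HasCompactSupport θ →
      tsupport θ ⊆ Ω →
      ∫ x in (Ω : Set _), (-Laplacian.laplacian θ x + (V x - e) * θ x) * (ψ x).re = 0 ∧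
        ∫ x in (Ω : Set _), (-Laplacian.laplacian θ x + (V x - e) * θ x) * (ψ x).im = 0 := by
    intro θ hθ hc hs
    have h1 := h (testOfReal θ hθ hc hs)
    rw [inner_schrodingerMap_sub_smul] at h1
    have hint : Integrable (fun x => schrodingerFun (fun x => V x - e) (testOfReal θ hθ hc hs) x *
        (starRingEnd ℂ) (ψ x)) (volume.restrict (Ω : Set _)) :=
      (schrodingerFun_memLp hWe (testOfReal θ hθ hc hs)).integrable_mul hψ.star
    have hre := Complex.reCLM.integral_comp_comm hint
    have him := Complex.imCLM.integral_comp_comm hint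
    rw [h1, map_zero] at hre him
    simp only [schrodingerFun_testOfReal, Complex.reCLM_apply, Complex.imCLM_apply,
      Complex.re_ofReal_mul, Complex.im_ofReal_mul, Complex.conj_re, Complex.conj_im,
      mul_neg, integral_neg, neg_eq_zero] at hre him
    exact ⟨hre, him⟩
  exact ⟨isWeakSolution_of_integral_eq_zero hWe hψ.re fun θ h1 h2 h3 => (key θ h1 h2 h3).1,
    isWeakSolution_of_integral_eq_zero hWe hψ.im fun θ h1 h2 h3 => (key θ h1 h2 h3).2⟩

/-- The terms of (-Δφ + Wφ)φ̄ mixing Re φ and Im φ are purely imaginary, so the real estimate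
applies to the two parts separately. -/
theorem norm_sq_testToL2_le_of_real {W : EuclideanSpace ℝ (Fin n) → ℝ} (hW : LocallyLInfty Ω W)
    (hreal : ∀ a : EuclideanSpace ℝ (Fin n) → ℝ, ContDiff ℝ 2 a → HasCompactSupport a →
      tsupport a ⊆ Ω →
      Integrable (fun x => a x * (-Laplacian.laplacian a x + W x * a x)) ∧
        ∫ x, a x ^ 2 ≤ ∫ x, a x * (-Laplacian.laplacian a x + W x * a x)) (φ : 𝓓(Ω, ℂ)) :
    ‖testToL2 Ω φ‖ ^ 2 ≤
      (∫ x in (Ω : Set _), schrodingerFun W φ x * (starRingEnd ℂ) (φ x)).re := by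
  set a : EuclideanSpace ℝ (Fin n) → ℝ := fun x => (φ x).re with ha
  set c : EuclideanSpace ℝ (Fin n) → ℝ := fun x => (φ x).im with hc
  have hφ2 : ContDiff ℝ 2 φ := contDiff_two_of_top φ.contDiff
  have hca : HasCompactSupport a := φ.hasCompactSupport.comp_left (g := Complex.re) rfl
  have hcc : HasCompactSupport c := φ.hasCompactSupport.comp_left (g := Complex.im) rfl
  have hda : ContDiff ℝ 2 a := Complex.reCLM.contDiff.comp hφ2
  have hdc : ContDiff ℝ 2 c := Complex.imCLM.contDiff.comp hφ2
  have hsa : tsupport a ⊆ Ω := by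
    refine (closure_mono fun x hx => ?_).trans φ.tsupport_subset
    exact fun h0 => hx (by simp [ha, h0])
  have hsc : tsupport c ⊆ Ω := by
    refine (closure_mono fun x hx => ?_).trans φ.tsupport_subset
    exact fun h0 => hx (by simp [hc, h0])
  have hLa : ∀ x, Laplacian.laplacian a x =
      (Laplacian.laplacian (φ : EuclideanSpace ℝ (Fin n) → ℂ) x).re := fun x =>
    (testFunction_contDiffAt φ x).laplacian_CLM_comp_left (l := Complex.reCLM)
  have hLc : ∀ x, Laplacian.laplacian c x =
      (Laplacian.laplacian (φ : EuclideanSpace ℝ (Fin n) → ℂ) x).im := fun x =>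
    (testFunction_contDiffAt φ x).laplacian_CLM_comp_left (l := Complex.imCLM)
  obtain ⟨ia, hIa⟩ := hreal a hda hca hsa
  obtain ⟨ic, hIc⟩ := hreal c hdc hcc hsc
  have ia2 : Integrable (fun x => a x ^ 2) := by
    simp only [sq]
    exact (hda.continuous.mul hda.continuous).integrable_of_hasCompactSupport hca.mul_left
  have ic2 : Integrable (fun x => c x ^ 2) := by
    simp only [sq]
    exact (hdc.continuous.mul hdc.continuous).integrable_of_hasCompactSupport hcc.mul_left
  have hz : ∀ x ∉ (Ω : Set (EuclideanSpace ℝ (Fin n))), φ x = 0 := fun x hx =>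
    image_eq_zero_of_notMem_tsupport fun h => hx (φ.tsupport_subset h)
  have hnorm : ‖testToL2 Ω φ‖ ^ 2 = ∫ x, (a x ^ 2 + c x ^ 2) := by
    have h1 := inner_self_eq_norm_sq (𝕜 := ℂ) (testToL2 Ω φ)
    rw [L2.inner_def] at h1
    have h2 : ∫ x in (Ω : Set _), inner ℂ (testToL2 Ω φ x) (testToL2 Ω φ x) =
        ∫ x in (Ω : Set _), ((a x ^ 2 + c x ^ 2 : ℝ) : ℂ) := by
      refine integral_congr_ae ?_
      filter_upwards [(testFunction_memLp φ).coeFn_toLp] with x hx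
      have hx' : testToL2 Ω φ x = φ x := hx
      rw [hx', RCLike.inner_apply, Complex.mul_conj, Complex.normSq_apply]
      simp only [ha, hc, sq]
    rw [h2, integral_complex_ofReal, setIntegral_eq_integral_of_forall_compl_eq_zero] at h1
    · simpa using h1.symm
    · intro x hx
      simp [ha, hc, hz x hx]
  have hre : (∫ x in (Ω : Set _), schrodingerFun W φ x * (starRingEnd ℂ) (φ x)).re =
      ∫ x, (a x * (-Laplacian.laplacian a x + W x * a x) +
        c x * (-Laplacian.laplacian c x + W x * c x)) := by
    have hint : Integrable (fun x => schrodingerFun W φ x * (starRingEnd ℂ) (φ x))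
        (volume.restrict (Ω : Set _)) :=
      (schrodingerFun_memLp hW φ).integrable_mul (testFunction_memLp φ).star
    have hcomm := Complex.reCLM.integral_comp_comm hint
    simp only [Complex.reCLM_apply] at hcomm
    rw [← hcomm, setIntegral_eq_integral_of_forall_compl_eq_zero]
    · refine integral_congr_ae (Eventually.of_forall fun x => ?_)
      simp only [hLa, hLc]
      simp only [schrodingerFun, ha, hc, Complex.mul_re, Complex.add_re, Complex.add_im,
        Complex.neg_re, Complex.neg_im, Complex.mul_im, Complex.ofReal_re, Complex.ofReal_im,
        Complex.conj_re, Complex.conj_im]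
      ring
    · intro x hx
      rw [hz x hx, map_zero, mul_zero, Complex.zero_re]
  rw [hnorm, hre, integral_add ia2 ic2, integral_add ia ic]
  exact add_le_add hIa hIc

end Schrodinger

/-! ### Choice of the energy shift and conclusion. -/

section Main

theorem exists_ae_neg_le_of_memLp_top {α : Type*} [MeasurableSpace α] {μ : Measure α} {f : α → ℝ}
    (hf : MemLp f ∞ μ) : ∃ M : ℝ, ∀ᵐ x ∂μ, -M ≤ f x := by
  refine ⟨(eLpNorm f ∞ μ).toReal, ?_⟩
  filter_upwards [ae_le_eLpNormEssSup (f := f) (μ := μ)] with x hx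
  rw [← eLpNorm_exponent_top] at hx
  have h := ENNReal.toReal_mono hf.eLpNorm_ne_top hx
  rw [toReal_enorm, Real.norm_eq_abs] at h
  linarith [neg_abs_le (f x)]

end Main

theorem theorem1 {n : ℕ} (hn : 1 ≤ n) (Ω : Opens (EuclideanSpace ℝ (Fin n)))
    (hbdd : Bornology.IsBounded (Ω : Set (EuclideanSpace ℝ (Fin n))))
    (hC2 : HasC2Boundary Ω)
    (V V₁ V₂ : EuclideanSpace ℝ (Fin n) → ℝ) (hV : LocallyLInfty Ω V)
    (hsum : ∀ᵐ x ∂volume.restrict (Ω : Set (EuclideanSpace ℝ (Fin n))), V x = V₁ x + V₂ x)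
    (G : ℝ → ℝ) (hG : ConditionSigma G)
    (hV₁ : ∀ᵐ x ∂volume.restrict (Ω : Set (EuclideanSpace ℝ (Fin n))),
      (deriv G (bdryDist Ω x)) ^ 2 ≤ V₁ x + 1 / 4 * (1 / (bdryDist Ω x) ^ 2))
    (hV₂ : MemLp V₂ ∞ (volume.restrict (Ω : Set (EuclideanSpace ℝ (Fin n))))) :
    IsEssentiallySelfAdjoint (schrodingerOp Ω V hV) := by
  -- For n ≥ 1 the space is unbounded, so the bounded set Ω has nonempty complement.
  have hnt : Nontrivial (EuclideanSpace ℝ (Fin n)) := by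
    have : Nonempty (Fin n) := ⟨⟨0, hn⟩⟩
    infer_instance
  have hne : (Ω : Set (EuclideanSpace ℝ (Fin n))) ≠ univ := fun h =>
    NormedSpace.unbounded_univ ℝ (EuclideanSpace ℝ (Fin n)) (h ▸ hbdd)
  obtain ⟨ρ, hρ, hball⟩ := hC2.exists_hasExteriorBalls hbdd
  obtain ⟨M, hM⟩ := exists_ae_neg_le_of_memLp_top hV₂
  set b := EuclideanSpace.basisFun (Fin n) ℝ
  -- Compensates the Hardy error 3K²/4 with K = n/ρ and the lower bound -M of V₂, with 1 to spare.
  set e : ℝ := -(3 / 4 * ((Fintype.card (Fin n) : ℝ) / ρ) ^ 2 + M + 1) with he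
  set W : EuclideanSpace ℝ (Fin n) → ℝ := fun x => V x - e with hW
  have hWL : LocallyLInfty Ω W := hV.sub_const e
  have hWG : ∀ᵐ x ∂volume.restrict (Ω : Set (EuclideanSpace ℝ (Fin n))),
      deriv G (Metric.infDist x (Ω : Set (EuclideanSpace ℝ (Fin n)))ᶜ) ^ 2 + 1 ≤
        1 / 4 * (1 / Metric.infDist x (Ω : Set (EuclideanSpace ℝ (Fin n)))ᶜ ^ 2)
          - 3 / 4 * ((Fintype.card (Fin n) : ℝ) / ρ) ^ 2 + W x := by
    filter_upwards [hsum, hV₁, hM, ae_restrict_mem Ω.isOpen.measurableSet] with x h1 h2 h3 hx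
    rw [bdryDist_eq_infDist_compl hne hx] at h2
    simp only [hW, he, h1]
    linarith
  have hW1 : ∀ᵐ x ∂volume.restrict (Ω : Set (EuclideanSpace ℝ (Fin n))),
      1 ≤ 1 / 4 * (1 / Metric.infDist x (Ω : Set (EuclideanSpace ℝ (Fin n)))ᶜ ^ 2)
          - 3 / 4 * ((Fintype.card (Fin n) : ℝ) / ρ) ^ 2 + W x := by
    filter_upwards [hWG] with x hx
    exact hx.trans' (le_add_of_nonneg_left (sq_nonneg _))
  refine isEssentiallySelfAdjoint_of_coercive (dense_range_testToL2 Ω)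
    (schrodingerOp_isFormalAdjoint hV) e (fun x => ?_) (fun ψ hψ => ?_)
  · obtain ⟨φ, hφ, hHφ⟩ := exists_of_mem_schrodingerOp_domain hV x
    rw [hHφ, ← hφ, inner_schrodingerMap_sub_smul]
    refine (norm_sq_testToL2_le_of_real hWL (fun a ha hc hs =>
      integral_sq_le_integral_schrodinger hρ Ω.isOpen hne hball b hWL hW1 ha hc hs)
      φ).trans_eq ?_
    congr 1
    refine integral_congr_ae ?_
    filter_upwards [(testFunction_memLp φ).coeFn_toLp] with y hy
    have hy' : testToL2 Ω φ y = φ y := hy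
    rw [hy']
  · have horth : ∀ φ : 𝓓(Ω, ℂ),
        inner ℂ ψ (schrodingerMap hV φ - (e : ℂ) • testToL2 Ω φ) = 0 := fun φ => by
      rw [← schrodingerOp_apply]
      exact hψ ⟨testToL2 Ω φ, LinearMap.mem_range_self _ φ⟩
    obtain ⟨hre, him⟩ := isWeakSolution_re_im_of_orthogonal hV e ψ horth
    have hmem := Lp.memLp ψ
    have zre := hre.ae_eq_zero hρ Ω.isOpen hne hbdd hball b
      ((memLp_indicator_iff_restrict Ω.isOpen.measurableSet).2 hmem.re)
      (fun x hx => indicator_of_notMem hx _) hWL hG hWG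
    have zim := him.ae_eq_zero hρ Ω.isOpen hne hbdd hball b
      ((memLp_indicator_iff_restrict Ω.isOpen.measurableSet).2 hmem.im)
      (fun x hx => indicator_of_notMem hx _) hWL hG hWG
    rw [Lp.ext_iff]
    filter_upwards [ae_restrict_of_ae zre, ae_restrict_of_ae zim,
      ae_restrict_mem Ω.isOpen.measurableSet,
      Lp.coeFn_zero ℂ 2 (volume.restrict (Ω : Set (EuclideanSpace ℝ (Fin n))))] with x h1 h2 hx h0
    rw [indicator_of_mem hx] at h1 h2
    rw [h0]
    exact Complex.ext h1 h2
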